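/- For a set $V\subset\mathbb R^3$ let $B(V)=\{y\in\mathbb R^3:\ \|x-y\|\le 1\text{ for all }x\in V\}$, and let $\mathrm{cr}(V)$ be the smallest radius of a closed ball that includes $V$. A point $v\in V$ is essential if $B(V)\subsetneq B(V\setminus\{v\})$. A finite set $V$ with $\mathrm{cr}(V)<1$ is tight if all its points are essential. The facets of the ball polytope $B(V)$ are the sets $F_p=\{x\in B(V):\|x-p\|=1\}$, $p\in V$. A point $z\in B(V)$ is a vertex of $B(V)$ if $\|z-p\|=1$ for at least three points $p\in V$, or if $z\in V$ and $\|z-p\|=1$ for exactly two points $p\in V$. Denote by $\mathrm{vert}\,B(V)$ the set of vertices. An edge of $B(V)$ is the closure of a connected component of $(F_p\cap F_q)\setminus \mathrm{vert}\,B(V)$ for some distinct $p,q\in V$. The $1$-skeleton of $B(V)$ is the multigraph whose vertices and edges are the vertices and edges of $B(V)$, where the ends of an edge are the vertices that it contains; different edges may have the same two ends (so parallel edges and digons are allowed). A multigraph is called $2$-connected if it has at least two vertices, is connected, and remains connected after the deletion of any one of its vertices. **Theorem 6.1.** Let $V\subset\mathbb R^3$ be finite and tight with $\#V\ge 3$ and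 $\mathrm{cr}(V)<1$. Then every edge of $B(V)$ contains exactly two (distinct) vertices of $B(V)$, so that the $1$-skeleton of $B(V)$ is a well-defined loopless multigraph, and this multigraph is $2$-connected. -/

import Mathlib

/-- Euclidean `3`-space. -/
abbrev E3 : Type := EuclideanSpace ℝ (Fin 3)

namespace BallPolytope

open scoped ENNReal

/-- The ball set `B(V)`: the intersection of the closed unit balls centered at the points of `V`. -/
def ballSet (V : Set E3) : Set E3 := {y | ∀ x ∈ V, dist y x ≤ 1}

/-- The circumradius: the smallest radius of a closed ball that includes `W`
(`∞` if `W` is unbounded, `0` if `W` is a single point). -/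
noncomputable def circumradius (W : Set E3) : ℝ≥0∞ :=
  sInf {r | ∃ c : E3, W ⊆ Metric.closedEBall c r}

/-- The essential points of `V`: those whose removal strictly enlarges the ball set. -/
def essentialPoints (V : Set E3) : Set E3 := {v ∈ V | ballSet V ⊂ ballSet (V \ {v})}

/-- A tight set: finite, of circumradius less than `1`, all of whose points are essential. -/
structure IsTight (V : Set E3) : Prop where
  finite : V.Finite
  circumradius_lt : circumradius V < 1
  essential : essentialPoints V = V

/-- The facet `F_p` of `B(V)` that corresponds to a point `p ∈ V`. -/
def facet (V : Set E3) (p : E3) : Set E3 := {x ∈ ballSet V | dist x p = 1}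

/-- A principal vertex of `B(V)`: a point of `B(V)` that lies on at least three facets. -/
def IsPrincipalVertex (V : Set E3) (z : E3) : Prop :=
  z ∈ ballSet V ∧ 3 ≤ {p ∈ V | z ∈ facet V p}.encard

/-- A dangling vertex of `B(V)`: a point of `V ∩ B(V)` that lies on exactly two facets. -/
def IsDanglingVertex (V : Set E3) (z : E3) : Prop :=
  z ∈ V ∧ z ∈ ballSet V ∧ {p ∈ V | z ∈ facet V p}.encard = 2

/-- The vertex set of `B(V)`. -/
def vertices (V : Set E3) : Set E3 := {z | IsPrincipalVertex V z ∨ IsDanglingVertex V z}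

/-- An edge of `B(V)`: the closure of a connected component of `(F_p ∩ F_q) \ vert B(V)`, where
`p` and `q` are distinct points of `V`. -/
def IsEdge (V : Set E3) (e : Set E3) : Prop :=
  ∃ p ∈ V, ∃ q ∈ V, p ≠ q ∧ ∃ x ∈ (facet V p ∩ facet V q) \ vertices V,
    e = closure (connectedComponentIn ((facet V p ∩ facet V q) \ vertices V) x)

/-- The `1`-skeleton of `B(V)`, as a multigraph: its vertices are the vertices of `B(V)`, its edges
are the edges of `B(V)` (as point sets, so that different edges with the same ends are counted
separately), and the ends of an edge are the vertices of `B(V)` that it contains. -/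
def skeleton (V : Set E3) : Graph E3 (Set E3) where
  vertexSet := vertices V
  IsLink e x y := IsEdge V e ∧ e ∩ vertices V = {x, y}
  isLink_symm := fun _ _ => ⟨fun _ _ h => ⟨h.1, h.2.trans (Set.pair_comm _ _)⟩⟩
  eq_or_eq_of_isLink_of_isLink := by
    intro e x y v w h h'
    have hx : x ∈ ({v, w} : Set E3) := by
      rw [← h'.2, h.2]
      exact Set.mem_insert _ _
    simpa using hx
  left_mem_of_isLink := by
    intro e x y h
    have hx : x ∈ e ∩ vertices V := by
      rw [h.2]
      exact Set.mem_insert _ _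
    exact hx.2

/-- A multigraph is connected if it has a vertex and any two of its vertices are joined by a
path. -/
def GraphConnected {α β : Type*} (G : Graph α β) : Prop :=
  G.vertexSet.Nonempty ∧
    ∀ x ∈ G.vertexSet, ∀ y ∈ G.vertexSet, Relation.ReflTransGen G.Adj x y

/-- A multigraph is `2`-connected if it has at least two vertices, is connected, and stays
connected when any one of its vertices is deleted. -/
def TwoConnected {α β : Type*} (G : Graph α β) : Prop :=
  2 ≤ G.vertexSet.encard ∧ GraphConnected G ∧
    ∀ z ∈ G.vertexSet, GraphConnected (G.deleteVerts {z})

end BallPolytope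

/-! Fix a point `z`. The frontier of the convex body B(V) is a topological sphere, and central
projection from `p` identifies the relative boundary of the facet of `p` with the frontier of a
planar convex body. Both stay connected without `z`. It follows that the union K of all facet
boundaries is connected without `z` (`isPreconnected_iUnion_facetBoundary_diff`): a splitting of K \
{z} into two closed parts would sort the facets into two classes, whose unions are closed, cover the
frontier without `z`, and therefore meet off `z`; a common point contradicts the splitting.

Tightness and the third point of V enter a second time through `exists_mem_circle_one_lt_dist`: the
circle that carries F_p ∩ F_q has a point outside B(V). Without that point the circle is a line, so
each component of F_p ∩ F_q off the vertices is a bounded open interval, and its ends are two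
distinct vertices (`exists_arc`).

There are finitely many vertices and edges, so the stars of vertex sets are closed. If some vertex
could not be reached from another while avoiding `z`, the stars of the reachable and of the
unreachable vertices would split K \ {z} (`reflTransGen_adj_ne`). A non-vertex `z` yields
connectedness, a vertex `z` yields 2-connectedness. -/

open Set Metric Topology
open scoped RealInnerProductSpace

/-! ### Frontiers of convex bodies with at most one point removed. -/

section ConvexBody

variable {E : Type*} [NormedAddCommGroup E] [InnerProductSpace ℝ E]

/-- Stereographic projection exhibits a sphere without one point as a continuous image of a linear
space. -/
theorem isPreconnected_sphere_diff_of_subsingleton (h : 1 < Module.rank ℝ E) {t : Set E}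
    (ht : t.Subsingleton) : IsPreconnected (sphere (0 : E) 1 \ t) := by
  rcases ht.eq_empty_or_singleton with rfl | ⟨z, rfl⟩
  · simpa using isPreconnected_sphere h 0 1
  by_cases hz : ‖z‖ = 1
  · have : sphere (0 : E) 1 \ {z} = range fun w => ((stereoInvFun hz w : sphere (0 : E) 1) : E) := by
      ext y
      constructor
      · rintro ⟨hy, hyz⟩
        exact ⟨_, congrArg Subtype.val (stereo_left_inv hz (x := ⟨y, hy⟩) hyz)⟩
      · rintro ⟨w, rfl⟩
        exact ⟨Subtype.coe_prop _, fun h => stereoInvFun_ne_north_pole hz w (Subtype.ext h)⟩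
    rw [this]
    exact isPreconnected_range (continuous_subtype_val.comp (continuous_stereoInvFun hz))
  · rw [sdiff_singleton_eq_self (by simpa using hz)]
    exact isPreconnected_sphere h 0 1

theorem Convex.isPreconnected_frontier_diff {s : Set E} (h : 1 < Module.rank ℝ E)
    (hs : Convex ℝ s) (hne : (interior s).Nonempty) (hb : Bornology.IsBounded s) {t : Set E}
    (ht : t.Subsingleton) : IsPreconnected (frontier s \ t) := by
  obtain ⟨φ, -, -, hφ⟩ := exists_homeomorph_image_interior_closure_frontier_eq_unitBall hs hne hb
  have : frontier s \ t = φ.symm '' (sphere 0 1 \ φ '' t) := by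
    rw [← hφ, ← image_sdiff φ.injective, ← image_comp]
    simp
  rw [this]
  exact (isPreconnected_sphere_diff_of_subsingleton h (ht.image φ)).image _ φ.symm.continuous.continuousOn

theorem Convex.infinite_frontier {s : Set E} (h : 1 < Module.rank ℝ E)
    (hs : Convex ℝ s) (hne : (interior s).Nonempty) (hb : Bornology.IsBounded s) :
    (frontier s).Infinite := by
  obtain ⟨φ, -, -, hφ⟩ := exists_homeomorph_image_interior_closure_frontier_eq_unitBall hs hne hb
  have : Nontrivial E := (rank_pos_iff_nontrivial (R := ℝ)).1 (zero_lt_one.trans h)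
  have hi : (sphere (0 : E) 1).Infinite := by
    refine (isPreconnected_sphere h 0 1).infinite_of_nontrivial ?_
    obtain ⟨v, hv⟩ := NormedSpace.sphere_nonempty (x := (0 : E)) (r := 1) |>.2 zero_le_one
    refine ⟨v, hv, -v, by simpa using hv, fun h => ?_⟩
    have h0 : (2 : ℝ) • v = 0 := by rw [two_smul]; nth_rewrite 2 [h]; simp
    simp [(smul_eq_zero_iff_right two_ne_zero).1 h0] at hv
  rw [← hφ] at hi
  exact hi.of_image _

/-- A bounded region that is cut out by finitely many concave inequalities, with a strictly
feasible point. -/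
structure ConcaveRegion {ι : Type*} (I : Set ι) (f : ι → E → ℝ) : Prop where
  finite : I.Finite
  concave : ∀ i ∈ I, ConcaveOn ℝ univ (f i)
  continuous : ∀ i ∈ I, Continuous (f i)
  bounded : Bornology.IsBounded {w | ∀ i ∈ I, 0 ≤ f i w}
  feasible : ∃ w, ∀ i ∈ I, 0 < f i w

namespace ConcaveRegion

variable {ι : Type*} {I : Set ι} {f : ι → E → ℝ}

theorem convex (h : ConcaveRegion I f) : Convex ℝ {w | ∀ i ∈ I, 0 ≤ f i w} := by
  have : {w | ∀ i ∈ I, 0 ≤ f i w} = ⋂ i ∈ I, {w | w ∈ univ ∧ 0 ≤ f i w} := by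
    ext; simp
  rw [this]
  exact convex_iInter₂ fun i hi => (h.concave i hi).convex_ge 0

theorem isOpen_pos (h : ConcaveRegion I f) : IsOpen {w | ∀ i ∈ I, 0 < f i w} := by
  have : {w | ∀ i ∈ I, 0 < f i w} = ⋂ i ∈ I, {w | 0 < f i w} := by
    ext; simp
  rw [this]
  exact h.finite.isOpen_biInter fun i hi => isOpen_lt continuous_const (h.continuous i hi)

theorem isClosed (h : ConcaveRegion I f) : IsClosed {w | ∀ i ∈ I, 0 ≤ f i w} := by
  have : {w | ∀ i ∈ I, 0 ≤ f i w} = ⋂ i ∈ I, {w | 0 ≤ f i w} := by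
    ext; simp
  rw [this]
  exact isClosed_biInter fun i hi => isClosed_le continuous_const (h.continuous i hi)

/-- Were some `f i` zero at an interior point `w`, one could move from `w` slightly away from the
strictly feasible `w₀` and stay in the region; concavity on the segment from there to `w₀` would
make `f i w` positive. -/
theorem interior_eq (h : ConcaveRegion I f) :
    interior {w | ∀ i ∈ I, 0 ≤ f i w} = {w | ∀ i ∈ I, 0 < f i w} := by
  refine Subset.antisymm (fun w hw i hi => ?_)
    (interior_maximal (fun w hw i hi => (hw i hi).le) h.isOpen_pos)
  have h0 := interior_subset hw i hi
  refine lt_of_le_of_ne h0 fun hzero => ?_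
  obtain ⟨w₀, hw₀⟩ := h.feasible
  have hc : ContinuousAt (fun s : ℝ => w + s • (w - w₀)) 0 := by fun_prop
  have hmem : ∀ᶠ s in 𝓝 (0 : ℝ), w + s • (w - w₀) ∈ {w | ∀ i ∈ I, 0 ≤ f i w} :=
    hc (by simpa only [zero_smul, add_zero] using mem_interior_iff_mem_nhds.1 hw)
  obtain ⟨s, hs, hs0⟩ := ((hmem.filter_mono nhdsWithin_le_nhds).and
    (self_mem_nhdsWithin : ∀ᶠ s in 𝓝[>] (0 : ℝ), s ∈ Ioi 0)).exists
  have hs0 : 0 < s := hs0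
  have := (h.concave i hi).2 (mem_univ (w + s • (w - w₀))) (mem_univ w₀)
    (show 0 ≤ 1 / (1 + s) by positivity) (show 0 ≤ s / (1 + s) by positivity) (by field_simp)
  have e : (1 / (1 + s)) • (w + s • (w - w₀)) + (s / (1 + s)) • w₀ = w := by
    have : (1 + s) ≠ 0 := by positivity
    match_scalars <;> field_simp
    ring
  rw [e, ← hzero] at this
  have h1 := hs i hi
  have h2 := hw₀ i hi
  have : 0 < (1 / (1 + s)) • f i (w + s • (w - w₀)) + (s / (1 + s)) • f i w₀ := by
    simp only [smul_eq_mul]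
    positivity
  linarith

theorem frontier_eq (h : ConcaveRegion I f) :
    frontier {w | ∀ i ∈ I, 0 ≤ f i w} = {w | (∀ i ∈ I, 0 ≤ f i w) ∧ ∃ i ∈ I, f i w = 0} := by
  rw [h.isClosed.frontier_eq, h.interior_eq]
  ext w
  simp only [mem_sdiff, mem_ofPred_eq, not_forall, not_lt, and_congr_right_iff]
  refine fun hw => ⟨fun ⟨i, hi, h⟩ => ⟨i, hi, le_antisymm h (hw i hi)⟩, fun ⟨i, hi, h⟩ => ⟨i, hi, h.le⟩⟩

theorem isPreconnected_boundary_diff (h : ConcaveRegion I f) (hr : 1 < Module.rank ℝ E) {t : Set E}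
    (ht : t.Subsingleton) :
    IsPreconnected ({w | (∀ i ∈ I, 0 ≤ f i w) ∧ ∃ i ∈ I, f i w = 0} \ t) := by
  rw [← h.frontier_eq]
  refine h.convex.isPreconnected_frontier_diff hr ?_ h.bounded ht
  rw [h.interior_eq]
  exact h.feasible

theorem infinite_boundary (h : ConcaveRegion I f) (hr : 1 < Module.rank ℝ E) :
    {w | (∀ i ∈ I, 0 ≤ f i w) ∧ ∃ i ∈ I, f i w = 0}.Infinite := by
  rw [← h.frontier_eq]
  refine h.convex.infinite_frontier hr ?_ h.bounded
  rw [h.interior_eq]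
  exact h.feasible

end ConcaveRegion

end ConvexBody

/-! ### The frontier of the ball set. -/

namespace BallPolytope

theorem one_lt_rank_E3 : 1 < Module.rank ℝ E3 :=
  Module.lt_rank_of_lt_finrank (by simp)

theorem isPreconnected_ballSet_boundary_diff {V : Set E3} (hV : V.Finite) (hne : V.Nonempty)
    {c : E3} (hc : ∀ x ∈ V, dist c x < 1) (z : E3) :
    IsPreconnected ({y | y ∈ ballSet V ∧ ∃ p ∈ V, dist y p = 1} \ {z}) := by
  have h : ConcaveRegion V fun x y : E3 => 1 - dist y x := by
    refine ⟨hV, fun x _ => ?_, fun x _ => by fun_prop, ?_, c, fun x hx => sub_pos.2 (hc x hx)⟩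
    · exact (concaveOn_const 1 convex_univ).sub (convexOn_dist x convex_univ)
    · obtain ⟨x, hx⟩ := hne
      exact isBounded_closedBall.subset (t := closedBall x 1) fun y hy => sub_nonneg.1 (hy x hx)
  have := h.isPreconnected_boundary_diff one_lt_rank_E3 (subsingleton_singleton (a := z))
  simp only [sub_nonneg, sub_eq_zero, eq_comm (a := (1 : ℝ))] at this
  exact this

end BallPolytope

/-! ### Facets in gnomonic coordinates. -/

namespace BallPolytope

/-- On the unit sphere around `p` the quadratic term is constant, so every other ball condition
becomes affine in `y`. -/
theorem dist_sq_eq_of_dist_eq_one {y p : E3} (hy : dist y p = 1) (x : E3) :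
    dist y x ^ 2 = 1 - 2 * (⟪y - p, x - p⟫ - ‖x - p‖ ^ 2 / 2) := by
  rw [dist_eq_norm] at *
  have : y - x = (y - p) - (x - p) := by abel
  rw [this, norm_sub_sq_real, hy]
  ring

theorem dist_le_one_iff_inner {y p : E3} (hy : dist y p = 1) (x : E3) :
    dist y x ≤ 1 ↔ 0 ≤ ⟪y - p, x - p⟫ - ‖x - p‖ ^ 2 / 2 := by
  rw [← sq_le_one_iff₀ dist_nonneg, dist_sq_eq_of_dist_eq_one hy]
  constructor <;> intro h <;> linarith

theorem dist_lt_one_iff_inner {y p : E3} (hy : dist y p = 1) (x : E3) :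
    dist y x < 1 ↔ 0 < ⟪y - p, x - p⟫ - ‖x - p‖ ^ 2 / 2 := by
  rw [← sq_lt_one_iff₀ dist_nonneg, dist_sq_eq_of_dist_eq_one hy]
  constructor <;> intro h <;> linarith

theorem dist_eq_one_iff_inner {y p : E3} (hy : dist y p = 1) (x : E3) :
    dist y x = 1 ↔ ⟪y - p, x - p⟫ - ‖x - p‖ ^ 2 / 2 = 0 := by
  rw [← pow_eq_one_iff_of_nonneg (dist_nonneg (x := y) (y := x)) two_ne_zero,
    dist_sq_eq_of_dist_eq_one hy]
  constructor <;> intro h <;> linarith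

/-- The gnomonic chart of the unit sphere around `p` on the open hemisphere centered in direction
`e`, with domain the plane orthogonal to `e`. -/
noncomputable def gnomonicLift (e : E3) (w : (ℝ ∙ e)ᗮ) : E3 := (‖e‖ ^ 2)⁻¹ • e + w

/-- The inverse of the gnomonic chart. -/
noncomputable def gnomonicInv (p e : E3) (w : (ℝ ∙ e)ᗮ) : E3 :=
  p + ‖gnomonicLift e w‖⁻¹ • gnomonicLift e w

section Gnomonic

variable {p e : E3}

theorem inner_gnomonicLift (he : e ≠ 0) (w : (ℝ ∙ e)ᗮ) : ⟪gnomonicLift e w, e⟫ = 1 := by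
  have : ⟪(w : E3), e⟫ = 0 := Submodule.mem_orthogonal_singleton_iff_inner_left.1 w.2
  rw [gnomonicLift, inner_add_left, this, real_inner_smul_left, real_inner_self_eq_norm_sq]
  have := norm_pos_iff.2 he
  field_simp
  ring

theorem gnomonicLift_ne_zero (he : e ≠ 0) (w : (ℝ ∙ e)ᗮ) : gnomonicLift e w ≠ 0 := by
  intro h
  simpa [h] using inner_gnomonicLift he w

theorem continuous_gnomonicLift : Continuous (gnomonicLift e) := by
  unfold gnomonicLift
  fun_prop

theorem continuous_gnomonicInv (he : e ≠ 0) : Continuous (gnomonicInv p e) := by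
  unfold gnomonicInv
  exact continuous_const.add ((continuous_gnomonicLift.norm.inv₀ fun w =>
    norm_ne_zero_iff.2 (gnomonicLift_ne_zero he w)).smul continuous_gnomonicLift)

theorem dist_gnomonicInv (he : e ≠ 0) (w : (ℝ ∙ e)ᗮ) : dist (gnomonicInv p e w) p = 1 := by
  rw [gnomonicInv, dist_eq_norm, add_sub_cancel_left, norm_smul, norm_inv, norm_norm]
  exact inv_mul_cancel₀ (norm_ne_zero_iff.2 (gnomonicLift_ne_zero he w))

theorem inner_gnomonicInv (he : e ≠ 0) (w : (ℝ ∙ e)ᗮ) (X : E3) :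
    ⟪gnomonicInv p e w - p, X⟫ - ‖X‖ ^ 2 / 2 =
      ‖gnomonicLift e w‖⁻¹ * (⟪gnomonicLift e w, X⟫ - ‖X‖ ^ 2 / 2 * ‖gnomonicLift e w‖) := by
  have := norm_pos_iff.2 (gnomonicLift_ne_zero he w)
  rw [gnomonicInv, add_sub_cancel_left, real_inner_smul_left]
  field_simp

theorem gnomonicInv_injective (he : e ≠ 0) : Function.Injective (gnomonicInv p e) := by
  intro w w' h
  have h1 : ‖gnomonicLift e w‖⁻¹ • gnomonicLift e w = ‖gnomonicLift e w'‖⁻¹ • gnomonicLift e w' :=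
    add_left_cancel h
  have h2 := congrArg (fun v : E3 => ⟪v, e⟫) h1
  simp only [real_inner_smul_left, inner_gnomonicLift he, mul_one] at h2
  rw [← h2] at h1
  have h3 := smul_right_injective E3 (inv_ne_zero (norm_ne_zero_iff.2 (gnomonicLift_ne_zero he w))) h1
  exact Subtype.ext (add_left_cancel h3)

theorem exists_gnomonicInv_eq (he : e ≠ 0) {y : E3} (hy : dist y p = 1) (hpos : 0 < ⟪y - p, e⟫) :
    ∃ w, gnomonicInv p e w = y := by
  have hw : ⟪y - p, e⟫⁻¹ • (y - p) - (‖e‖ ^ 2)⁻¹ • e ∈ (ℝ ∙ e)ᗮ := by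
    rw [Submodule.mem_orthogonal_singleton_iff_inner_left, inner_sub_left, real_inner_smul_left,
      real_inner_smul_left, real_inner_self_eq_norm_sq]
    have := norm_pos_iff.2 he
    field_simp
    ring
  refine ⟨⟨_, hw⟩, ?_⟩
  have hl : gnomonicLift e ⟨_, hw⟩ = ⟪y - p, e⟫⁻¹ • (y - p) := by simp [gnomonicLift]
  rw [dist_eq_norm] at hy
  rw [gnomonicInv, hl, norm_smul, hy, norm_inv, Real.norm_of_nonneg hpos.le, mul_one, inv_inv,
    smul_smul, mul_inv_cancel₀ hpos.ne', one_smul, add_sub_cancel]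

end Gnomonic

/-- The relative boundary of a facet: its points that lie on some other facet. -/
def facetBoundary (V : Set E3) (p : E3) : Set E3 :=
  {y | y ∈ facet V p ∧ ∃ q ∈ V, q ≠ p ∧ dist y q = 1}

/-- The facet lies in the open hemisphere toward `q`, because its points satisfy the half-space
condition of `q`; so the chart covers it. After multiplication by the norm of the lift, the
condition of `x` is an affine function of `w` minus a nonnegative multiple of a norm, hence concave.
The point `a` supplies strict feasibility. -/
theorem facetBoundary_chart {V : Set E3} (hV : V.Finite) {p q a : E3} (hq : q ∈ V)
    (hqp : q ≠ p) (ha : dist a p = 1) (ha' : ∀ x ∈ V, x ≠ p → dist a x < 1) :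
    ∃ f : E3 → (ℝ ∙ (q - p))ᗮ → ℝ, ConcaveRegion (V \ {p}) f ∧
      facetBoundary V p = gnomonicInv p (q - p) ''
        {w | (∀ x ∈ V \ {p}, 0 ≤ f x w) ∧ ∃ x ∈ V \ {p}, f x w = 0} := by
  have he : q - p ≠ 0 := sub_ne_zero.2 hqp
  have he' := norm_pos_iff.2 he
  set f : E3 → (ℝ ∙ (q - p))ᗮ → ℝ := fun x w =>
    ⟪gnomonicLift (q - p) w, x - p⟫ - ‖x - p‖ ^ 2 / 2 * ‖gnomonicLift (q - p) w‖ with hf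
  have hn (w) : 0 < ‖gnomonicLift (q - p) w‖⁻¹ :=
    inv_pos.2 (norm_pos_iff.2 (gnomonicLift_ne_zero he w))
  have hle (x w) : dist (gnomonicInv p (q - p) w) x ≤ 1 ↔ 0 ≤ f x w := by
    rw [dist_le_one_iff_inner (dist_gnomonicInv he w), inner_gnomonicInv he]
    exact mul_nonneg_iff_of_pos_left (hn w)
  have hlt (x w) : dist (gnomonicInv p (q - p) w) x < 1 ↔ 0 < f x w := by
    rw [dist_lt_one_iff_inner (dist_gnomonicInv he w), inner_gnomonicInv he]
    exact mul_pos_iff_of_pos_left (hn w)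
  have heq (x w) : dist (gnomonicInv p (q - p) w) x = 1 ↔ f x w = 0 := by
    rw [dist_eq_one_iff_inner (dist_gnomonicInv he w), inner_gnomonicInv he]
    exact mul_eq_zero_iff_left (hn w).ne'
  have hex {y : E3} (hy : dist y p = 1) (hyq : dist y q ≤ 1) :
      ∃ w, gnomonicInv p (q - p) w = y := by
    refine exists_gnomonicInv_eq he hy ?_
    have := (dist_le_one_iff_inner hy q).1 hyq
    have : 0 < ‖q - p‖ ^ 2 := by positivity
    linarith
  refine ⟨f, ⟨hV.subset sdiff_subset, fun x _ => ?_, fun x _ => ?_, ?_, ?_⟩, ?_⟩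
  · have h1 : ConcaveOn ℝ univ fun w : (ℝ ∙ (q - p))ᗮ => ⟪gnomonicLift (q - p) w, x - p⟫ := by
      refine ⟨convex_univ, fun u _ v _ a b _ _ hab => le_of_eq ?_⟩
      simp only [gnomonicLift, inner_add_left, Submodule.coe_add, Submodule.coe_smul,
        real_inner_smul_left, smul_eq_mul]
      linear_combination (⟪q - p, x - p⟫ * (‖q - p‖ ^ 2)⁻¹) * hab
    have h2 : ConvexOn ℝ univ fun w : (ℝ ∙ (q - p))ᗮ => ‖gnomonicLift (q - p) w‖ := by
      refine ⟨convex_univ, fun u _ v _ a b ha hb hab => ?_⟩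
      have : gnomonicLift (q - p) (a • u + b • v) =
          a • gnomonicLift (q - p) u + b • gnomonicLift (q - p) v := by
        have hb : b = 1 - a := by linarith
        simp only [gnomonicLift, Submodule.coe_add, Submodule.coe_smul, hb]
        module
      simp only [this, smul_eq_mul]
      refine (norm_add_le _ _).trans ?_
      rw [norm_smul, norm_smul, Real.norm_of_nonneg ha, Real.norm_of_nonneg hb]
    exact h1.sub (h2.smul (c := ‖x - p‖ ^ 2 / 2) (by positivity))
  · exact (continuous_gnomonicLift.inner continuous_const).sub
      (continuous_const.mul continuous_gnomonicLift.norm)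
  -- The lift has constant inner product 1 with `q - p`, so the condition of `q` alone bounds its
  -- norm by 2 / ‖q - p‖².
  · refine isBounded_closedBall.subset (t := closedBall 0 (2 / ‖q - p‖ ^ 2 + ‖q - p‖⁻¹))
      fun w hw => ?_
    have h1 : 0 ≤ f q w := hw q ⟨hq, hqp⟩
    simp only [hf, inner_gnomonicLift he] at h1
    have h2 : ‖gnomonicLift (q - p) w‖ ≤ 2 / ‖q - p‖ ^ 2 := by
      rw [le_div_iff₀ (by positivity)]
      linarith
    have h3 : (w : E3) = gnomonicLift (q - p) w - (‖q - p‖ ^ 2)⁻¹ • (q - p) := by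
      simp [gnomonicLift]
    have h4 : ‖(‖q - p‖ ^ 2)⁻¹ • (q - p)‖ = ‖q - p‖⁻¹ := by
      rw [norm_smul, norm_inv, norm_pow, norm_norm]
      field_simp
    rw [mem_closedBall_zero_iff, Submodule.coe_norm, h3]
    refine (norm_sub_le _ _).trans ?_
    rw [h4]
    linarith
  · obtain ⟨w, rfl⟩ := hex ha (ha' q hq hqp).le
    exact ⟨w, fun x hx => (hlt x w).1 (ha' x hx.1 hx.2)⟩
  · ext y
    constructor
    · rintro ⟨⟨hyB, hyp⟩, x, hx, hxp, hyx⟩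
      obtain ⟨w, rfl⟩ := hex hyp (hyB q hq)
      exact ⟨w, ⟨fun x hx => (hle x w).1 (hyB x hx.1), x, ⟨hx, hxp⟩, (heq x w).1 hyx⟩, rfl⟩
    · rintro ⟨w, ⟨hw, x, hx, hwx⟩, rfl⟩
      refine ⟨⟨fun x hx => ?_, dist_gnomonicInv he w⟩, x, hx.1, hx.2, (heq x w).2 hwx⟩
      by_cases hxp : x = p
      · rw [hxp, dist_gnomonicInv he w]
      · exact (hle x w).2 (hw x ⟨hx, hxp⟩)

theorem one_lt_rank_orthogonal {e : E3} (he : e ≠ 0) : 1 < Module.rank ℝ (ℝ ∙ e)ᗮ := by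
  have : Fact (Module.finrank ℝ E3 = 2 + 1) := ⟨by simp⟩
  refine Module.lt_rank_of_lt_finrank ?_
  rw [Submodule.finrank_orthogonal_span_singleton (n := 2) he]
  norm_num

theorem isPreconnected_facetBoundary_diff {V : Set E3} (hV : V.Finite) {p q a : E3}
    (hq : q ∈ V) (hqp : q ≠ p) (ha : dist a p = 1) (ha' : ∀ x ∈ V, x ≠ p → dist a x < 1)
    (z : E3) : IsPreconnected (facetBoundary V p \ {z}) := by
  obtain ⟨f, hf, h⟩ := facetBoundary_chart hV hq hqp ha ha'
  have he : q - p ≠ 0 := sub_ne_zero.2 hqp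
  rw [h, ← image_sdiff_preimage]
  exact (hf.isPreconnected_boundary_diff (one_lt_rank_orthogonal he)
    (subsingleton_singleton.preimage (gnomonicInv_injective he))).image _
      (continuous_gnomonicInv he).continuousOn

theorem infinite_facetBoundary {V : Set E3} (hV : V.Finite) {p q a : E3}
    (hq : q ∈ V) (hqp : q ≠ p) (ha : dist a p = 1) (ha' : ∀ x ∈ V, x ≠ p → dist a x < 1) :
    (facetBoundary V p).Infinite := by
  obtain ⟨f, hf, h⟩ := facetBoundary_chart hV hq hqp ha ha'
  have he : q - p ≠ 0 := sub_ne_zero.2 hqp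
  rw [h]
  exact (hf.infinite_boundary (one_lt_rank_orthogonal he)).image (gnomonicInv_injective he).injOn

end BallPolytope

/-! ### The circle of points at distance 1 from two centers. -/

namespace BallPolytope

theorem finite_setOf_quadratic_eq_zero {A B C : ℝ} (h : ¬(A = 0 ∧ B = 0 ∧ C = 0)) :
    {t : ℝ | A * t ^ 2 + B * t + C = 0}.Finite := by
  by_contra hinf
  let P : Polynomial ℝ := .C A * .X ^ 2 + .C B * .X + .C C
  have hP (t : ℝ) : P.eval t = A * t ^ 2 + B * t + C := by simp [P]
  have h0 : P = 0 := P.eq_zero_of_infinite_isRoot <| by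
    simp only [Polynomial.IsRoot, hP]
    exact hinf
  have h1 := hP 0
  have h2 := hP 1
  have h3 := hP (-1)
  simp only [h0, Polynomial.eval_zero] at h1 h2 h3
  exact h ⟨by linarith, by linarith, by linarith⟩

section Circle

variable {p q y : E3}

theorem dist_sq_of_sub_midpoint :
    dist y p ^ 2 = ‖y - midpoint ℝ p q‖ ^ 2 + ⟪y - midpoint ℝ p q, q - p⟫ + ‖q - p‖ ^ 2 / 4 ∧
    dist y q ^ 2 = ‖y - midpoint ℝ p q‖ ^ 2 - ⟪y - midpoint ℝ p q, q - p⟫ + ‖q - p‖ ^ 2 / 4 := by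
  have h1 : y - p = (y - midpoint ℝ p q) + (1 / 2 : ℝ) • (q - p) := by
    rw [midpoint_eq_smul_add, invOf_eq_inv]
    module
  have h2 : y - q = (y - midpoint ℝ p q) - (1 / 2 : ℝ) • (q - p) := by
    rw [midpoint_eq_smul_add, invOf_eq_inv]
    module
  rw [dist_eq_norm, dist_eq_norm, h1, h2, norm_add_sq_real,
    norm_sub_sq_real (y - midpoint ℝ p q) ((1 / 2 : ℝ) • (q - p)), norm_smul,
    real_inner_smul_right, Real.norm_of_nonneg (by norm_num : (0 : ℝ) ≤ 1 / 2)]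
  constructor <;> ring

theorem dist_eq_one_pair_iff :
    dist y p = 1 ∧ dist y q = 1 ↔
      ⟪y - midpoint ℝ p q, q - p⟫ = 0 ∧ ‖y - midpoint ℝ p q‖ ^ 2 = 1 - ‖q - p‖ ^ 2 / 4 := by
  obtain ⟨h1, h2⟩ := dist_sq_of_sub_midpoint (p := p) (q := q) (y := y)
  rw [← pow_eq_one_iff_of_nonneg (dist_nonneg (x := y) (y := p)) two_ne_zero,
    ← pow_eq_one_iff_of_nonneg (dist_nonneg (x := y) (y := q)) two_ne_zero, h1, h2]
  constructor <;> rintro ⟨h3, h4⟩ <;> constructor <;> linarith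

/-- Coordinates relative to the midpoint of `p` and `q`: `h` is half their distance and `r` the
radius of the circle. The point of the lens has axial coordinate `b` and distance `s` from the axis;
the third center has axial coordinate `a` and distance `ω` from the axis, on the side opposite to a
circle point. If that circle point is within 1 of the third center, then |a| ≤ h, and with s ≤ r and
b² + 2|b|h + s² ≤ r² the bound follows by expanding. -/
theorem lens_inequality {a b h r s ω : ℝ} (hh : 0 ≤ h) (hr : 0 ≤ r) (hω : 0 ≤ ω)
    (hrh : r ^ 2 + h ^ 2 = 1) (h1 : (b + h) ^ 2 + s ^ 2 ≤ 1) (h2 : (b - h) ^ 2 + s ^ 2 ≤ 1)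
    (h3 : a ^ 2 + (r + ω) ^ 2 ≤ 1) : (b - a) ^ 2 + (s + ω) ^ 2 ≤ 1 := by
  have hsr : s ≤ r := abs_le_of_sq_le_sq' (by nlinarith) hr |>.2
  have ha : |a| ≤ h := abs_le_of_sq_le_sq (by nlinarith [mul_nonneg hr hω, sq_nonneg ω]) hh
  have hb : b ^ 2 + 2 * |b| * h + s ^ 2 ≤ r ^ 2 := by
    rcases abs_cases b with ⟨hb, -⟩ | ⟨hb, -⟩ <;> rw [hb] <;> nlinarith
  have hab : -(a * b) ≤ |b| * |a| := by
    rw [← abs_mul, mul_comm b a]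
    exact neg_le_abs _
  have : |b| * |a| ≤ |b| * h := mul_le_mul_of_nonneg_left ha (abs_nonneg b)
  have : ω * s ≤ ω * r := mul_le_mul_of_nonneg_left hsr hω
  nlinarith

/-- The minus sign makes `u` point away from `X`, so that moving from the midpoint along `u` leads
to the point of the circle farthest from the third center. -/
theorem exists_unit_orthogonal {n : E3} (hn : ‖n‖ = 1) (X : E3) :
    ∃ u : E3, ‖u‖ = 1 ∧ ⟪u, n⟫ = 0 ∧ X = ⟪X, n⟫ • n - ‖X - ⟪X, n⟫ • n‖ • u := by
  have hn0 : n ≠ 0 := by rintro rfl; simp at hn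
  have hnn : ⟪n, n⟫ = 1 := by rw [real_inner_self_eq_norm_sq, hn, one_pow]
  by_cases hX : X - ⟪X, n⟫ • n = 0
  · have : Nontrivial (ℝ ∙ n)ᗮ :=
      (rank_pos_iff_nontrivial (R := ℝ)).1 (zero_lt_one.trans (one_lt_rank_orthogonal hn0))
    obtain ⟨u, hu⟩ := NormedSpace.sphere_nonempty (x := (0 : (ℝ ∙ n)ᗮ)) (r := 1) |>.2 zero_le_one
    refine ⟨u, by simpa using hu, Submodule.mem_orthogonal_singleton_iff_inner_left.1 u.2, ?_⟩
    rw [hX, norm_zero, zero_smul, sub_zero]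
    exact sub_eq_zero.1 hX
  · have hX' := norm_pos_iff.2 hX
    refine ⟨-(‖X - ⟪X, n⟫ • n‖⁻¹ • (X - ⟪X, n⟫ • n)), ?_, ?_, ?_⟩
    · rw [norm_neg, norm_smul, norm_inv, norm_norm, inv_mul_cancel₀ hX'.ne']
    · rw [inner_neg_left, real_inner_smul_left, inner_sub_left, real_inner_smul_left, hnn]
      ring
    · rw [smul_neg, smul_smul, mul_inv_cancel₀ hX'.ne']
      module

theorem norm_sq_eq_inner_sq_add {n : E3} (hn : ‖n‖ = 1) (Y : E3) :
    ‖Y‖ ^ 2 = ⟪Y, n⟫ ^ 2 + ‖Y - ⟪Y, n⟫ • n‖ ^ 2 := by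
  rw [norm_sub_sq_real, real_inner_smul_right, norm_smul, hn, mul_one, Real.norm_eq_abs, sq_abs]
  ring

/-- If a point of the intersection of the unit balls around `p` and `q` lies outside the unit ball
around `x`, then so does a point at distance exactly `1` from both `p` and `q`. -/
theorem exists_mem_circle_one_lt_dist (hpq : p ≠ q) (hyp : dist y p ≤ 1) (hyq : dist y q ≤ 1)
    {x : E3} (hyx : 1 < dist y x) : ∃ y₀, dist y₀ p = 1 ∧ dist y₀ q = 1 ∧ 1 < dist y₀ x := by
  set m := midpoint ℝ p q with hm
  have hD : 0 < ‖q - p‖ := norm_pos_iff.2 (sub_ne_zero.2 hpq.symm)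
  obtain ⟨n, hn1, hDn⟩ : ∃ n : E3, ‖n‖ = 1 ∧ q - p = ‖q - p‖ • n := by
    refine ⟨‖q - p‖⁻¹ • (q - p), ?_, ?_⟩
    · rw [norm_smul, norm_inv, norm_norm, inv_mul_cancel₀ hD.ne']
    · rw [smul_smul, mul_inv_cancel₀ hD.ne', one_smul]
  have hnn : ⟪n, n⟫ = 1 := by rw [real_inner_self_eq_norm_sq, hn1, one_pow]
  obtain ⟨u, hu1, hun, hxu⟩ := exists_unit_orthogonal hn1 (x - m)
  set a := ⟪x - m, n⟫
  set ω := ‖x - m - a • n‖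
  set b := ⟪y - m, n⟫ with hb
  set s := ‖y - m - b • n‖ with hs
  have hnu : ⟪n, u⟫ = 0 := by rwa [real_inner_comm]
  have hs2 : ‖y - m‖ ^ 2 = b ^ 2 + s ^ 2 := norm_sq_eq_inner_sq_add hn1 (y - m)
  obtain ⟨h1, h2⟩ := dist_sq_of_sub_midpoint (p := p) (q := q) (y := y)
  have hinner : ⟪y - m, q - p⟫ = ‖q - p‖ * b := by rw [hDn, real_inner_smul_right, ← hDn]
  rw [← hm, hinner, hs2] at h1 h2
  have hh1 : (b + ‖q - p‖ / 2) ^ 2 + s ^ 2 ≤ 1 := by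
    have := pow_le_one₀ (n := 2) dist_nonneg hyp
    nlinarith
  have hh2 : (b - ‖q - p‖ / 2) ^ 2 + s ^ 2 ≤ 1 := by
    have := pow_le_one₀ (n := 2) dist_nonneg hyq
    nlinarith
  have hr0 : 0 ≤ 1 - ‖q - p‖ ^ 2 / 4 := by nlinarith
  set r := √(1 - ‖q - p‖ ^ 2 / 4) with hr
  have hr2 : r ^ 2 = 1 - ‖q - p‖ ^ 2 / 4 := Real.sq_sqrt hr0
  have hy₀ : dist (m + r • u) p = 1 ∧ dist (m + r • u) q = 1 := by
    rw [dist_eq_one_pair_iff, ← hm, add_sub_cancel_left, norm_smul, hu1, mul_one, Real.norm_eq_abs,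
      sq_abs, hr2, hDn, real_inner_smul_right, real_inner_smul_left, hun, mul_zero, mul_zero]
    exact ⟨rfl, by rw [← hDn]⟩
  refine ⟨m + r • u, hy₀.1, hy₀.2, lt_of_not_ge fun hle => hyx.not_ge ?_⟩
  have h3 : dist (m + r • u) x ^ 2 = a ^ 2 + (r + ω) ^ 2 := by
    have : m + r • u - x = (r + ω) • u - a • n := by
      have : x = m + (a • n - ω • u) := by rw [← hxu]; abel
      rw [this]
      module
    rw [dist_eq_norm, this, norm_sub_sq_real, norm_smul, norm_smul, hu1, hn1, real_inner_smul_left,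
      real_inner_smul_right, hun, mul_one, mul_one, Real.norm_eq_abs, Real.norm_eq_abs, sq_abs,
      sq_abs]
    ring
  have h4 : dist y x ^ 2 ≤ (b - a) ^ 2 + (s + ω) ^ 2 := by
    have e : y - x = (b - a) • n + (y - m - b • n + ω • u) := by
      have : x = m + (a • n - ω • u) := by rw [← hxu]; abel
      rw [this]
      module
    have hin : ⟪n, y - m - b • n + ω • u⟫ = 0 := by
      rw [inner_add_right, inner_sub_right, real_inner_smul_right, real_inner_smul_right, hnn, hnu,
        hb, real_inner_comm]
      ring
    have hle : ‖y - m - b • n + ω • u‖ ≤ s + ω := by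
      refine (norm_add_le _ _).trans (le_of_eq ?_)
      rw [norm_smul, hu1, mul_one, Real.norm_of_nonneg (norm_nonneg _)]
    rw [dist_eq_norm, e, norm_add_sq_real, real_inner_smul_left, hin, norm_smul, hn1, mul_one,
      Real.norm_eq_abs, sq_abs]
    have := pow_le_pow_left₀ (norm_nonneg _) hle 2
    linarith
  have h5 := lens_inequality (h := ‖q - p‖ / 2) (by positivity)
    (Real.sqrt_nonneg _) (norm_nonneg _) (by rw [← hr, hr2]; ring) hh1 hh2
    (h3 ▸ pow_le_one₀ dist_nonneg hle)
  exact (sq_le_one_iff₀ dist_nonneg).1 (h4.trans h5)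

/-- `γ` parametrizes the circle of points at distance `1` from `p` and `q`, with `y₀` removed, by
the real line, and `τ` is its inverse. -/
structure IsCircleChart (p q y₀ : E3) (γ : ℝ → E3) (τ : E3 → ℝ) : Prop where
  continuous : Continuous γ
  continuousOn_symm : ContinuousOn τ {y | dist y p = 1 ∧ dist y q = 1 ∧ y ≠ y₀}
  left_inv : ∀ t, τ (γ t) = t
  dist_left : ∀ t, dist (γ t) p = 1
  dist_right : ∀ t, dist (γ t) q = 1
  ne : ∀ t, γ t ≠ y₀
  right_inv : ∀ y, dist y p = 1 → dist y q = 1 → y ≠ y₀ → γ (τ y) = y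
  finite : ∀ x y, dist y p = 1 → dist y q = 1 → dist y x ≠ 1 → {t | dist (γ t) x = 1}.Finite

/-- This is stereographic projection of the circle from `y₀`. -/
theorem exists_isCircleChart (hpq : p ≠ q) (hlt : dist p q < 2) {y₀ : E3} (hp : dist y₀ p = 1)
    (hq : dist y₀ q = 1) : ∃ γ τ, IsCircleChart p q y₀ γ τ := by
  set m := midpoint ℝ p q with hm
  have hD : 0 < ‖q - p‖ := norm_pos_iff.2 (sub_ne_zero.2 hpq.symm)
  have hD2 : ‖q - p‖ < 2 := by rwa [← dist_eq_norm, dist_comm]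
  obtain ⟨hin, hnorm⟩ := dist_eq_one_pair_iff.1 ⟨hp, hq⟩
  rw [← hm] at hin hnorm
  set r := ‖y₀ - m‖ with hr
  have hr0 : 0 < r := by
    refine (norm_nonneg _).lt_of_ne' fun h => ?_
    rw [← hr] at h
    rw [h] at hnorm
    nlinarith
  obtain ⟨b, hb⟩ := Orthonormal.exists_orthonormalBasis_extension_of_card_eq (𝕜 := ℝ) (E := E3)
    (ι := Fin 3) (by simp) (v := ![‖q - p‖⁻¹ • (q - p), r⁻¹ • (y₀ - m), 0]) (s := {0, 1}) (by
      rw [orthonormal_iff_ite]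
      rintro ⟨i, hi⟩ ⟨j, hj⟩
      have hin' : ⟪q - p, y₀ - m⟫ = 0 := by rwa [real_inner_comm]
      have h1 : ⟪y₀ - m, y₀ - m⟫ = r * r := real_inner_self_eq_norm_mul_norm _
      have h2 : ⟪q - p, q - p⟫ = ‖q - p‖ * ‖q - p‖ := real_inner_self_eq_norm_mul_norm _
      have h10 : (1 : Fin 3) ≠ 0 := by decide
      rcases hi with rfl | rfl <;> rcases hj with rfl | rfl <;>
        simp [-inner_self_eq_norm_sq_to_K, real_inner_smul_left,
          real_inner_smul_right, hin, hin', h1, h2, hD.ne', hr0.ne', Subtype.ext_iff])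
  have hb0 : b 0 = ‖q - p‖⁻¹ • (q - p) := hb 0 (by simp)
  have hb1 : b 1 = r⁻¹ • (y₀ - m) := hb 1 (by simp)
  set u := b 1 with hu
  set v := b 2 with hv
  have huu : ⟪u, u⟫ = 1 := by simp [hu]
  have hvv : ⟪v, v⟫ = 1 := by simp [hv]
  have huv : ⟪u, v⟫ = 0 := by simp [hu, hv, b.inner_eq_ite]
  have hvu : ⟪v, u⟫ = 0 := by simp [hu, hv, b.inner_eq_ite]
  have hDb : q - p = ‖q - p‖ • b 0 := by rw [hb0, smul_smul, mul_inv_cancel₀ hD.ne', one_smul]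
  have hun : ⟪u, q - p⟫ = 0 := by rw [hDb, real_inner_smul_right]; simp [hu, b.inner_eq_ite]
  have hvn : ⟪v, q - p⟫ = 0 := by rw [hDb, real_inner_smul_right]; simp [hv, b.inner_eq_ite]
  have hy₀ : y₀ = m + r • u := by
    rw [hb1, smul_smul, mul_inv_cancel₀ hr0.ne', one_smul, add_sub_cancel]
  have hcoord (y : E3) (hyp : dist y p = 1) (hyq : dist y q = 1) :
      y = m + ⟪y - m, u⟫ • u + ⟪y - m, v⟫ • v ∧ ⟪y - m, u⟫ ^ 2 + ⟪y - m, v⟫ ^ 2 = r ^ 2 := by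
    obtain ⟨h1, h2⟩ := dist_eq_one_pair_iff.1 ⟨hyp, hyq⟩
    rw [← hm] at h1 h2
    have h3 := b.sum_repr' (y - m)
    have h0 : ⟪b 0, y - m⟫ = 0 := by rw [hb0, real_inner_smul_left, real_inner_comm, h1, mul_zero]
    rw [Fin.sum_univ_three, h0, zero_smul, zero_add, ← hu, ← hv, real_inner_comm,
      real_inner_comm (y - m) v] at h3
    refine ⟨by rw [add_assoc, h3]; abel, ?_⟩
    rw [hnorm, ← h2, ← real_inner_self_eq_norm_sq]
    nth_rewrite 3 [← h3]
    rw [inner_add_left, real_inner_smul_left, real_inner_smul_left, real_inner_comm,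
      real_inner_comm (y - m) v]
    ring
  have hcirc (α β : ℝ) (h : α ^ 2 + β ^ 2 = r ^ 2) :
      dist (m + α • u + β • v) p = 1 ∧ dist (m + α • u + β • v) q = 1 := by
    rw [dist_eq_one_pair_iff, ← hm, ← hnorm, ← h, add_assoc, add_sub_cancel_left]
    constructor
    · simp [inner_add_left, real_inner_smul_left, hun, hvn]
    · rw [← real_inner_self_eq_norm_sq]
      simp only [inner_add_left, inner_add_right, real_inner_smul_left, real_inner_smul_right, huu,
        hvv, huv, hvu]
      ring
  have hdist (α β : ℝ) (h : α ^ 2 + β ^ 2 = r ^ 2) (x : E3) :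
      dist (m + α • u + β • v) x ^ 2 =
        r ^ 2 + ‖x - m‖ ^ 2 - 2 * (α * ⟪u, x - m⟫ + β * ⟪v, x - m⟫) := by
    have e : m + α • u + β • v - x = (α • u + β • v) - (x - m) := by abel
    have e' : ‖α • u + β • v‖ ^ 2 = r ^ 2 := by
      rw [← h, ← real_inner_self_eq_norm_sq]
      simp only [inner_add_left, inner_add_right, real_inner_smul_left, real_inner_smul_right, huu,
        hvv, huv, hvu]
      ring
    rw [dist_eq_norm, e, norm_sub_sq_real, e', inner_add_left, real_inner_smul_left,
      real_inner_smul_left]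
    ring
  -- The rational parametrization of the circle of radius `r`, with `y₀` as the limit when `t` tends
  -- to infinity.
  set A : ℝ → ℝ := fun t => r * (t ^ 2 - 1) / (1 + t ^ 2) with hA
  set B : ℝ → ℝ := fun t => 2 * r * t / (1 + t ^ 2) with hB
  have hpos (t : ℝ) : 0 < 1 + t ^ 2 := by positivity
  have hAB (t : ℝ) : A t ^ 2 + B t ^ 2 = r ^ 2 := by
    have := (hpos t).ne'
    simp only [hA, hB]
    field_simp
    ring
  have hAr (t : ℝ) : r - A t = 2 * r / (1 + t ^ 2) := by
    have := (hpos t).ne'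
    simp only [hA]
    field_simp
    ring
  set γ : ℝ → E3 := fun t => m + A t • u + B t • v with hγ
  have hγu (t : ℝ) : ⟪γ t - m, u⟫ = A t := by
    rw [hγ]
    simp only [add_assoc, add_sub_cancel_left, inner_add_left, real_inner_smul_left, huu, hvu]
    ring
  have hγv (t : ℝ) : ⟪γ t - m, v⟫ = B t := by
    rw [hγ]
    simp only [add_assoc, add_sub_cancel_left, inner_add_left, real_inner_smul_left, huv, hvv]
    ring
  have hy₀u : ⟪y₀ - m, u⟫ = r := by rw [hy₀, add_sub_cancel_left, real_inner_smul_left, huu, mul_one]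
  have hsub (y : E3) (hyp : dist y p = 1) (hyq : dist y q = 1) (hy : y ≠ y₀) :
      0 < r - ⟪y - m, u⟫ := by
    obtain ⟨h1, h2⟩ := hcoord y hyp hyq
    have hle : ⟪y - m, u⟫ ≤ r := (abs_le_of_sq_le_sq' (by nlinarith) hr0.le).2
    refine sub_pos.2 (hle.lt_of_ne fun h => hy ?_)
    rw [h] at h1 h2
    have h3 : ⟪y - m, v⟫ = 0 := by
      rw [← sq_eq_zero_iff]
      linarith
    rw [h1, h3, zero_smul, add_zero, ← hy₀]
  refine ⟨γ, fun y => ⟪y - m, v⟫ / (r - ⟪y - m, u⟫), ⟨?_, ?_, fun t => ?_, fun t => ?_, fun t => ?_,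
    fun t h => ?_, fun y hyp hyq hy => ?_, fun x y hyp hyq hyx => ?_⟩⟩
  · have : Continuous A := by
      simp only [hA]
      exact Continuous.div (by fun_prop) (by fun_prop) fun t => (hpos t).ne'
    have : Continuous B := by
      simp only [hB]
      exact Continuous.div (by fun_prop) (by fun_prop) fun t => (hpos t).ne'
    fun_prop
  · refine ContinuousOn.div ?_ ?_ fun y hy => (hsub y hy.1 hy.2.1 hy.2.2).ne'
    · exact ((continuous_id.sub continuous_const).inner continuous_const).continuousOn
    · exact (continuous_const.sub
        ((continuous_id.sub continuous_const).inner continuous_const)).continuousOn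
  · have := (hpos t).ne'
    rw [hγu, hγv, hAr]
    simp only [hB]
    field_simp
  · exact (hcirc _ _ (hAB t)).1
  · exact (hcirc _ _ (hAB t)).2
  · have h1 := hAr t
    rw [← hγu, h, hy₀u, sub_self] at h1
    have : 0 < 2 * r / (1 + t ^ 2) := div_pos (by positivity) (hpos t)
    linarith
  · have h0 := hsub y hyp hyq hy
    obtain ⟨h1, h2⟩ := hcoord y hyp hyq
    set α := ⟪y - m, u⟫
    set β := ⟪y - m, v⟫
    have e : 1 + (β / (r - α)) ^ 2 = 2 * r / (r - α) := by
      field_simp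
      linear_combination h2
    have eA : A (β / (r - α)) = α := by
      have : (β / (r - α)) ^ 2 - 1 = 2 * α / (r - α) := by
        field_simp
        linear_combination h2
      simp only [hA]
      rw [e, this]
      field_simp
    have eB : B (β / (r - α)) = β := by
      simp only [hB]
      rw [e]
      field_simp
    simp only [hγ]
    rw [eA, eB, ← h1]
  · set k := r ^ 2 + ‖x - m‖ ^ 2 - 1 with hk
    set a := ⟪u, x - m⟫ with ha
    set b' := ⟪v, x - m⟫ with hb'
    -- This is the condition that `γ t` has distance 1 from `x`, multiplied by 1 + t². If all
    -- coefficients vanish, then `k`, `a` and `b'` vanish and the whole circle is at distance 1 from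
    -- `x`, contrary to the choice of `y`.
    have hfin : {t : ℝ | (k - 2 * r * a) * t ^ 2 + (-(4 * r * b')) * t + (k + 2 * r * a) = 0}.Finite := by
      refine finite_setOf_quadratic_eq_zero fun ⟨h1, h2, h3⟩ => hyx ?_
      have hb0 : b' = 0 := by
        have : 4 * r ≠ 0 := by positivity
        exact (mul_eq_zero.1 (neg_eq_zero.1 h2)).resolve_left this
      have ha0 : a = 0 := by
        have : 4 * r ≠ 0 := by positivity
        exact (mul_eq_zero.1 (show 4 * r * a = 0 by linarith)).resolve_left this
      obtain ⟨h4, h5⟩ := hcoord y hyp hyq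
      have h6 := hdist _ _ h5 x
      rw [← h4, ← ha, ← hb', ha0, hb0] at h6
      rw [ha0] at h1
      rw [← pow_eq_one_iff_of_nonneg dist_nonneg two_ne_zero, h6]
      linarith
    refine hfin.subset fun t ht => ?_
    have h1 : dist (γ t) x ^ 2 = 1 := by rw [show dist (γ t) x = 1 from ht, one_pow]
    have h2 := hdist _ _ (hAB t) x
    rw [h1, ← ha, ← hb'] at h2
    have h3 : k - 2 * (A t * a + B t * b') = 0 := by rw [hk]; linarith
    have := (hpos t).ne'
    simp only [hA, hB] at h3
    field_simp at h3
    simp only [mem_ofPred_eq]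
    linear_combination h3

end Circle

end BallPolytope

/-! ### Arcs of pairwise intersections of facets. -/

theorem IsOpen.exists_connectedComponentIn_eq_Ioo {O : Set ℝ} (hO : IsOpen O) {t l u : ℝ}
    (ht : t ∈ O) (hl : l ∉ O) (hlt : l ≤ t) (hu : u ∉ O) (htu : t ≤ u) :
    ∃ a b, a < b ∧ a ∉ O ∧ b ∉ O ∧ Ioo a b ⊆ O ∧ connectedComponentIn O t = Ioo a b := by
  have hA : IsClosed (Oᶜ ∩ Iic t) := hO.isClosed_compl.inter isClosed_Iic
  have hB : IsClosed (Oᶜ ∩ Ici t) := hO.isClosed_compl.inter isClosed_Ici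
  have hAb : BddAbove (Oᶜ ∩ Iic t) := ⟨t, fun _ h => h.2⟩
  have hBb : BddBelow (Oᶜ ∩ Ici t) := ⟨t, fun _ h => h.2⟩
  obtain ⟨haO, hat⟩ := hA.csSup_mem ⟨l, hl, hlt⟩ hAb
  obtain ⟨hbO, htb⟩ := hB.csInf_mem ⟨u, hu, htu⟩ hBb
  set a := sSup (Oᶜ ∩ Iic t)
  set b := sInf (Oᶜ ∩ Ici t)
  have hat : a < t := lt_of_le_of_ne hat fun h => haO (h ▸ ht)
  have htb : t < b := lt_of_le_of_ne htb fun h => hbO (h ▸ ht)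
  have hsub : Ioo a b ⊆ O := fun s hs => by
    by_contra hsO
    rcases le_total s t with h | h
    · exact hs.1.not_ge (le_csSup hAb ⟨hsO, h⟩)
    · exact hs.2.not_ge (csInf_le hBb ⟨hsO, h⟩)
  refine ⟨a, b, hat.trans htb, haO, hbO, hsub, Subset.antisymm (fun s hs => ?_)
    (isPreconnected_Ioo.subset_connectedComponentIn ⟨hat, htb⟩ hsub)⟩
  have hord := (isPreconnected_connectedComponentIn (F := O) (x := t)).ordConnected
  have htc := mem_connectedComponentIn ht
  by_contra hs'
  rcases not_and_or.1 hs' with h | h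
  · exact haO (connectedComponentIn_subset O t (hord.out hs htc ⟨not_lt.1 h, hat.le⟩))
  · exact hbO (connectedComponentIn_subset O t (hord.out htc hs ⟨htb.le, not_lt.1 h⟩))

theorem Set.encard_pair_le_two {α : Type*} (a b : α) : ({a, b} : Set α).encard ≤ 2 := by
  refine (encard_insert_le _ _).trans ?_
  rw [encard_singleton]
  norm_num

namespace BallPolytope

variable {V : Set E3}

theorem isClosed_ballSet (V : Set E3) : IsClosed (ballSet V) := by
  have : ballSet V = ⋂ x ∈ V, closedBall x 1 := by
    ext
    simp [ballSet]
  rw [this]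
  exact isClosed_biInter fun _ _ => isClosed_closedBall

theorem isClosed_facet (V : Set E3) (p : E3) : IsClosed (facet V p) :=
  (isClosed_ballSet V).inter (isClosed_eq (by fun_prop) continuous_const)

theorem isCompact_facet (V : Set E3) (p : E3) : IsCompact (facet V p) :=
  (isCompact_sphere p 1).of_isClosed_subset (isClosed_facet V p) fun _ h => h.2

theorem exists_dist_lt_one_of_circumradius_lt (h : circumradius V < 1) :
    ∃ c, ∀ x ∈ V, dist c x < 1 := by
  obtain ⟨r, ⟨c, hc⟩, hr⟩ := sInf_lt_iff.1 h
  refine ⟨c, fun x hx => ?_⟩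
  have h1 : edist x c < 1 := lt_of_le_of_lt (hc hx) hr
  rw [dist_comm, dist_edist]
  exact (ENNReal.toReal_lt_toReal h1.ne_top ENNReal.one_ne_top).2 h1

theorem exists_one_lt_dist_of_mem_essentialPoints {v : E3} (h : v ∈ essentialPoints V) :
    ∃ y, 1 < dist y v ∧ ∀ x ∈ V, x ≠ v → dist y x ≤ 1 := by
  obtain ⟨-, -, h⟩ := h
  obtain ⟨y, hy, hyV⟩ := not_subset.1 h
  refine ⟨y, lt_of_not_ge fun hle => hyV fun x hx => ?_, fun x hx hxv => hy x ⟨hx, hxv⟩⟩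
  by_cases hxv : x = v
  · rwa [hxv]
  · exact hy x ⟨hx, hxv⟩

/-- A finite set of at least three points, strictly inside some unit ball, each of which can be
separated from the others by a unit ball. -/
structure IsThreeTight (V : Set E3) : Prop where
  finite : V.Finite
  card : 3 ≤ V.encard
  center : ∃ c, ∀ x ∈ V, dist c x < 1
  separated : ∀ p ∈ V, ∃ y, 1 < dist y p ∧ ∀ x ∈ V, x ≠ p → dist y x ≤ 1

namespace IsThreeTight

theorem nonempty (h : IsThreeTight V) : V.Nonempty := by
  rw [← encard_pos]
  exact lt_of_lt_of_le (by norm_num) h.card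

theorem exists_ne_ne (h : IsThreeTight V) (p q : E3) : ∃ x ∈ V, x ≠ p ∧ x ≠ q := by
  by_contra! hx
  have hsub : V ⊆ {p, q} := fun x hxV => by
    by_cases hxp : x = p
    · exact Or.inl hxp
    · exact Or.inr (hx x hxV hxp)
  have := (h.card.trans (encard_le_encard hsub)).trans (encard_pair_le_two p q)
  norm_num at this

/-- The segment from the center `c`, strictly inside all balls, to a point outside only the ball of
`p` crosses the sphere of `p` before its end; there convexity keeps the other distances strictly
below 1. -/
theorem exists_strict_facet_point (h : IsThreeTight V) {p : E3} (hp : p ∈ V) :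
    ∃ a, dist a p = 1 ∧ ∀ x ∈ V, x ≠ p → dist a x < 1 := by
  obtain ⟨c, hc⟩ := h.center
  obtain ⟨y, hyp, hy⟩ := h.separated p hp
  have hcont : ContinuousOn (fun t : ℝ => dist (AffineMap.lineMap c y t) p) (Icc 0 1) := by
    fun_prop
  obtain ⟨t, ht, htp⟩ := intermediate_value_Icc zero_le_one hcont
    (show (1 : ℝ) ∈ Icc _ _ by simpa using ⟨(hc p hp).le, hyp.le⟩)
  refine ⟨_, htp, fun x hx hxp => ?_⟩
  have ht1 : t < 1 := lt_of_le_of_ne ht.2 fun h1 => by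
    simp [h1] at htp
    linarith
  have hconv := (convexOn_dist x convex_univ).2 (mem_univ c) (mem_univ y) (sub_nonneg.2 ht.2) ht.1
    (by ring)
  rw [AffineMap.lineMap_apply_module]
  refine lt_of_le_of_lt hconv ?_
  simp only [smul_eq_mul]
  nlinarith [hc x hx, hy x hx hxp, ht.1]

theorem dist_lt_two (h : IsThreeTight V) {p q : E3} (hp : p ∈ V) (hq : q ∈ V) : dist p q < 2 := by
  obtain ⟨c, hc⟩ := h.center
  have := dist_triangle_left p q c
  linarith [hc p hp, hc q hq]

theorem exists_mem_circle (h : IsThreeTight V) {p q x : E3} (hp : p ∈ V) (hq : q ∈ V)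
    (hpq : p ≠ q) (hx : x ∈ V) (hxp : x ≠ p) (hxq : x ≠ q) :
    ∃ y, dist y p = 1 ∧ dist y q = 1 ∧ 1 < dist y x := by
  obtain ⟨y, hyx, hy⟩ := h.separated x hx
  exact exists_mem_circle_one_lt_dist hpq (hy p hp hxp.symm) (hy q hq hxq.symm) hyx

/-- A third center cuts off part of the circle, so the omitted point can be taken outside B(V) and
the chart covers all of F_p ∩ F_q. -/
theorem exists_chart (h : IsThreeTight V) {p q : E3} (hp : p ∈ V) (hq : q ∈ V) (hpq : p ≠ q) :
    ∃ y₀ γ τ, IsCircleChart p q y₀ γ τ ∧ y₀ ∉ ballSet V ∧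
      ∀ x ∈ V, x ≠ p → x ≠ q → {t | dist (γ t) x = 1}.Finite := by
  obtain ⟨x, hx, hxp, hxq⟩ := h.exists_ne_ne p q
  obtain ⟨y₀, h1, h2, h3⟩ := h.exists_mem_circle hp hq hpq hx hxp hxq
  obtain ⟨γ, τ, hγ⟩ := exists_isCircleChart hpq (h.dist_lt_two hp hq) h1 h2
  refine ⟨y₀, γ, τ, hγ, fun hB => h3.not_ge (hB x hx), fun x' hx' hxp' hxq' => ?_⟩
  obtain ⟨y, h4, h5, h6⟩ := h.exists_mem_circle hp hq hpq hx' hxp' hxq'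
  exact hγ.finite x' y h4 h5 h6.ne'

end IsThreeTight

theorem mem_vertices_iff_of_mem_facets {p q y : E3} (hp : p ∈ V) (hq : q ∈ V) (hpq : p ≠ q)
    (hyp : y ∈ facet V p) (hyq : y ∈ facet V q) :
    y ∈ vertices V ↔ y ∈ V ∨ ∃ x ∈ V, x ≠ p ∧ x ≠ q ∧ dist y x = 1 := by
  constructor
  · rintro (⟨-, h⟩ | ⟨h, -, -⟩)
    · right
      by_contra! hx
      have hsub : {x ∈ V | y ∈ facet V x} ⊆ {p, q} := fun x hxV => by
        by_cases hxp : x = p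
        · exact Or.inl hxp
        by_cases hxq : x = q
        · exact Or.inr hxq
        exact absurd hxV.2.2 (hx x hxV.1 hxp hxq)
      have := (h.trans (encard_le_encard hsub)).trans (encard_pair_le_two p q)
      norm_num at this
    · exact Or.inl h
  · intro h
    by_cases hx : ∃ x ∈ V, x ≠ p ∧ x ≠ q ∧ dist y x = 1
    · obtain ⟨x, hx, hxp, hxq, hyx⟩ := hx
      refine Or.inl ⟨hyp.1, ?_⟩
      have h3 : ({x, p, q} : Set E3).encard = 3 := encard_eq_three.2 ⟨x, p, q, hxp, hxq, hpq, rfl⟩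
      rw [← h3]
      refine encard_le_encard ?_
      rintro _ (rfl | rfl | rfl)
      exacts [⟨hx, hyp.1, hyx⟩, ⟨hp, hyp⟩, ⟨hq, hyq⟩]
    · refine Or.inr ⟨h.resolve_right hx, hyp.1, ?_⟩
      push Not at hx
      rw [← encard_pair hpq]
      congr 1
      refine Subset.antisymm (fun x hxV => ?_) ?_
      · by_cases hxp : x = p
        · exact Or.inl hxp
        by_cases hxq : x = q
        · exact Or.inr hxq
        exact absurd hxV.2.2 (hx x hxV.1 hxp hxq)
      · rintro _ (rfl | rfl)
        exacts [⟨hp, hyp⟩, ⟨hq, hyq⟩]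

theorem exists_facets_of_mem_vertices {y : E3} (hy : y ∈ vertices V) :
    ∃ p ∈ V, ∃ q ∈ V, p ≠ q ∧ y ∈ facet V p ∧ y ∈ facet V q := by
  have h : 1 < {p ∈ V | y ∈ facet V p}.encard := by
    rcases hy with ⟨-, h⟩ | ⟨-, -, h⟩
    · exact lt_of_lt_of_le (by norm_num) h
    · rw [h]
      norm_num
  obtain ⟨p, q, hp, hq, hpq⟩ := one_lt_encard_iff.1 h
  exact ⟨p, hp.1, q, hq.1, hpq, hp.2, hq.2⟩

namespace IsCircleChart

variable {p q y₀ : E3} {γ : ℝ → E3} {τ : E3 → ℝ}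

theorem right_inv_of_mem (h : IsCircleChart p q y₀ γ τ) (hy₀ : y₀ ∉ ballSet V) {y : E3}
    (hyp : y ∈ facet V p) (hyq : y ∈ facet V q) : γ (τ y) = y :=
  h.right_inv y hyp.2 hyq.2 fun e => hy₀ (e ▸ hyp.1)

theorem continuousOn_facets (h : IsCircleChart p q y₀ γ τ) (hy₀ : y₀ ∉ ballSet V) :
    ContinuousOn τ (facet V p ∩ facet V q) :=
  h.continuousOn_symm.mono fun _ hy => ⟨hy.1.2, hy.2.2, fun e => hy₀ (e ▸ hy.1.1)⟩

theorem preimage_facets (h : IsCircleChart p q y₀ γ τ) (hy₀ : y₀ ∉ ballSet V) :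
    γ ⁻¹' (facet V p ∩ facet V q) = τ '' (facet V p ∩ facet V q) := by
  ext t
  constructor
  · intro ht
    exact ⟨γ t, ht, h.left_inv t⟩
  · rintro ⟨y, hy, rfl⟩
    rwa [mem_preimage, h.right_inv_of_mem hy₀ hy.1 hy.2]

/-- On the circle, being a non-vertex of B(V) means strict inequality for all other centers and not
belonging to the finite set `V`; both are open conditions. -/
theorem isOpen_preimage (h : IsCircleChart p q y₀ γ τ) (hV : V.Finite) (hp : p ∈ V) (hq : q ∈ V)
    (hpq : p ≠ q) : IsOpen (γ ⁻¹' ((facet V p ∩ facet V q) \ vertices V)) := by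
  have : γ ⁻¹' ((facet V p ∩ facet V q) \ vertices V) =
      (⋂ x ∈ V \ {p, q}, {t | dist (γ t) x < 1}) ∩ γ ⁻¹' Vᶜ := by
    ext t
    simp only [mem_preimage, mem_sdiff, mem_inter_iff, mem_iInter, mem_insert_iff,
      mem_singleton_iff, mem_compl_iff, not_or, and_imp]
    constructor
    · rintro ⟨⟨h1, h2⟩, h3⟩
      rw [mem_vertices_iff_of_mem_facets hp hq hpq h1 h2] at h3
      push Not at h3
      exact ⟨fun x hx hxp hxq => lt_of_le_of_ne (h1.1 x hx) (h3.2 x hx hxp hxq), h3.1⟩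
    · rintro ⟨h1, h2⟩
      have hB : γ t ∈ ballSet V := fun x hx => by
        by_cases hxp : x = p
        · rw [hxp, h.dist_left]
        by_cases hxq : x = q
        · rw [hxq, h.dist_right]
        exact (h1 x hx hxp hxq).le
      have hp' : γ t ∈ facet V p := ⟨hB, h.dist_left t⟩
      have hq' : γ t ∈ facet V q := ⟨hB, h.dist_right t⟩
      refine ⟨⟨hp', hq'⟩, ?_⟩
      rw [mem_vertices_iff_of_mem_facets hp hq hpq hp' hq']
      rintro (h3 | ⟨x, hx, hxp, hxq, h3⟩)
      · exact h2 h3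
      · exact (h1 x hx hxp hxq).ne h3
  rw [this]
  refine (hV.sdiff.isOpen_biInter fun x _ => ?_).inter (hV.isClosed.isOpen_compl.preimage h.continuous)
  exact isOpen_lt (h.continuous.dist continuous_const) continuous_const

theorem injective (h : IsCircleChart p q y₀ γ τ) : Function.Injective γ :=
  Function.LeftInverse.injective h.left_inv

/-- The structure of a component of a pairwise intersection of facets without the vertices: it is
an open arc between two vertices. -/
theorem exists_arc (h : IsCircleChart p q y₀ γ τ) (hV : V.Finite) (hp : p ∈ V) (hq : q ∈ V)
    (hpq : p ≠ q) (hy₀ : y₀ ∉ ballSet V) {x : E3} (hx : x ∈ (facet V p ∩ facet V q) \ vertices V) :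
    ∃ a b, a < b ∧ γ a ∈ vertices V ∧ γ b ∈ vertices V ∧
      γ '' Icc a b ⊆ facet V p ∩ facet V q ∧
      γ '' Ioo a b ⊆ (facet V p ∩ facet V q) \ vertices V ∧
      connectedComponentIn ((facet V p ∩ facet V q) \ vertices V) x = γ '' Ioo a b ∧
      closure (connectedComponentIn ((facet V p ∩ facet V q) \ vertices V) x) = γ '' Icc a b := by
  set F := facet V p ∩ facet V q with hF
  set P := F \ vertices V with hP
  have hFcl : IsClosed F := (isClosed_facet V p).inter (isClosed_facet V q)
  have hcpt : IsCompact (γ ⁻¹' F) := by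
    rw [h.preimage_facets hy₀]
    exact ((isCompact_facet V p).inter_right (isClosed_facet V q)).image_of_continuousOn
      (h.continuousOn_facets hy₀)
  obtain ⟨l, hl⟩ := hcpt.bddBelow
  obtain ⟨u, hu⟩ := hcpt.bddAbove
  have hγx : γ (τ x) = x := h.right_inv_of_mem hy₀ hx.1.1 hx.1.2
  have hxF : τ x ∈ γ ⁻¹' F := by
    rw [mem_preimage, hγx]
    exact hx.1
  -- The bounds `l` and `u` may themselves be attained, so they are shifted by 1 to lie outside the
  -- compact preimage.
  obtain ⟨a, b, hab, ha, hb, hsub, hcomp⟩ :=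
    (h.isOpen_preimage hV hp hq hpq).exists_connectedComponentIn_eq_Ioo
    (t := τ x) (l := l - 1) (u := u + 1) (by rwa [mem_preimage, hγx])
    (fun h' => by have := hl (show l - 1 ∈ γ ⁻¹' F from h'.1); linarith)
    (by linarith [hl hxF])
    (fun h' => by have := hu (show u + 1 ∈ γ ⁻¹' F from h'.1); linarith)
    (by linarith [hu hxF])
  -- The ends stay in the closed set `F`; as they leave `P`, they can only be vertices.
  have hIcc : Icc a b ⊆ γ ⁻¹' F := by
    rw [← closure_Ioo hab.ne]
    exact closure_minimal (fun t ht => (hsub ht).1) hcpt.isClosed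
  have hvert {t : ℝ} (ht : t ∈ Icc a b) (ht' : t ∉ γ ⁻¹' P) : γ t ∈ vertices V := by
    by_contra hn
    exact ht' ⟨hIcc ht, hn⟩
  have hcc : connectedComponentIn P x = γ '' Ioo a b := by
    rw [← hcomp]
    refine Subset.antisymm (fun y hy => ?_) ?_
    · have hyP := connectedComponentIn_subset P x hy
      refine ⟨τ y, ?_, h.right_inv_of_mem hy₀ hyP.1.1 hyP.1.2⟩
      have hpre : IsPreconnected (τ '' connectedComponentIn P x) :=
        isPreconnected_connectedComponentIn.image _ ((h.continuousOn_facets hy₀).mono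
          ((connectedComponentIn_subset P x).trans sdiff_subset))
      refine hpre.subset_connectedComponentIn (mem_image_of_mem _ (mem_connectedComponentIn hx)) ?_
        (mem_image_of_mem _ hy)
      rintro _ ⟨w, hw, rfl⟩
      have hwP := connectedComponentIn_subset P x hw
      rwa [mem_preimage, h.right_inv_of_mem hy₀ hwP.1.1 hwP.1.2]
    · refine (isPreconnected_connectedComponentIn.image _ h.continuous.continuousOn
        ).subset_connectedComponentIn ⟨τ x, mem_connectedComponentIn ?_, hγx⟩ ?_
      · rwa [mem_preimage, hγx]
      · rintro _ ⟨w, hw, rfl⟩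
        exact connectedComponentIn_subset (γ ⁻¹' P) _ hw
  refine ⟨a, b, hab, hvert (left_mem_Icc.2 hab.le) ha, hvert (right_mem_Icc.2 hab.le) hb,
    image_subset_iff.2 hIcc, image_subset_iff.2 hsub, hcc, ?_⟩
  rw [hcc]
  refine Subset.antisymm (closure_minimal (image_mono Ioo_subset_Icc_self)
    (isCompact_Icc.image h.continuous).isClosed) ?_
  rw [← closure_Ioo hab.ne]
  exact image_closure_subset_closure_image h.continuous

end IsCircleChart

theorem IsEdge.isClosed {e : Set E3} (he : IsEdge V e) : IsClosed e := by
  obtain ⟨p, -, q, -, -, x, -, rfl⟩ := he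
  exact isClosed_closure

/-! ### Finiteness, ends of edges, and the union of the facet boundaries. -/

namespace IsThreeTight

theorem finite_vertices_inter (h : IsThreeTight V) {p q : E3} (hp : p ∈ V) (hq : q ∈ V)
    (hpq : p ≠ q) : (vertices V ∩ (facet V p ∩ facet V q)).Finite := by
  obtain ⟨y₀, γ, τ, hγ, hy₀, hfin⟩ := h.exists_chart hp hq hpq
  refine (h.finite.union ((h.finite.subset (sdiff_subset (t := {p, q}))).biUnion fun x hx =>
    (hfin x hx.1 (fun e => hx.2 (Or.inl e)) (fun e => hx.2 (Or.inr e))).image γ)).subset ?_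
  rintro y ⟨hy, hyp, hyq⟩
  rcases (mem_vertices_iff_of_mem_facets hp hq hpq hyp hyq).1 hy with hyV | ⟨x, hx, hxp, hxq, hyx⟩
  · exact Or.inl hyV
  · refine Or.inr (mem_biUnion (x := x) ⟨hx, by simp [hxp, hxq]⟩ ⟨τ y, ?_, ?_⟩)
    · rwa [mem_ofPred_eq, hγ.right_inv_of_mem hy₀ hyp hyq]
    · exact hγ.right_inv_of_mem hy₀ hyp hyq

theorem finite_vertices (h : IsThreeTight V) : (vertices V).Finite := by
  refine ((h.finite.prod h.finite).subset (sdiff_subset (t := {c : E3 × E3 | c.1 = c.2}))).biUnion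
    (fun c hc => h.finite_vertices_inter hc.1.1 hc.1.2 hc.2) |>.subset fun y hy => ?_
  obtain ⟨p, hp, q, hq, hpq, hyp, hyq⟩ := exists_facets_of_mem_vertices hy
  exact mem_biUnion (x := (p, q)) ⟨⟨hp, hq⟩, hpq⟩ ⟨hy, hyp, hyq⟩

/-- The edge is an injective image of a nondegenerate interval, so it cannot close up into a loop.
-/
theorem exists_inter_vertices_eq_pair (h : IsThreeTight V) {e : Set E3} (he : IsEdge V e) :
    ∃ x y, x ≠ y ∧ e ∩ vertices V = {x, y} := by
  obtain ⟨p, hp, q, hq, hpq, x, hx, rfl⟩ := he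
  obtain ⟨y₀, γ, τ, hγ, hy₀, -⟩ := h.exists_chart hp hq hpq
  obtain ⟨a, b, hab, ha, hb, -, hIoo, -, he⟩ := hγ.exists_arc h.finite hp hq hpq hy₀ hx
  rw [he]
  refine ⟨γ a, γ b, fun e => hab.ne (hγ.injective e), Subset.antisymm ?_ ?_⟩
  · rintro _ ⟨⟨t, ht, rfl⟩, htv⟩
    rcases eq_or_ne t a with rfl | hta
    · exact Or.inl rfl
    rcases eq_or_ne t b with rfl | htb
    · exact Or.inr rfl
    exact absurd htv (hIoo ⟨t, ⟨ht.1.lt_of_ne' hta, ht.2.lt_of_ne htb⟩, rfl⟩).2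
  · rintro _ (rfl | rfl)
    exacts [⟨⟨a, left_mem_Icc.2 hab.le, rfl⟩, ha⟩, ⟨⟨b, right_mem_Icc.2 hab.le, rfl⟩, hb⟩]

/-- A non-vertex lies on no third facet, so it determines the pair of facets and hence the
component. Different edges therefore meet only in vertices. -/
theorem eq_closure_of_mem_edge (h : IsThreeTight V) {e : Set E3} (he : IsEdge V e) {p q y : E3}
    (hp : p ∈ V) (hq : q ∈ V) (hpq : p ≠ q) (hy : y ∈ (facet V p ∩ facet V q) \ vertices V)
    (hye : y ∈ e) : e = closure (connectedComponentIn ((facet V p ∩ facet V q) \ vertices V) y) := by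
  obtain ⟨p', hp', q', hq', hpq', x, hx, rfl⟩ := he
  obtain ⟨y₀, γ, τ, hγ, hy₀, -⟩ := h.exists_chart hp' hq' hpq'
  obtain ⟨a, b, hab, ha, hb, hIcc, -, hcc, he⟩ := hγ.exists_arc h.finite hp' hq' hpq' hy₀ hx
  rw [he] at hye
  have hyF := hIcc hye
  have hne {x : E3} (hx : x ∈ V) (hyx : y ∈ facet V x) : x = p' ∨ x = q' := by
    by_contra! hn
    exact hy.2 ((mem_vertices_iff_of_mem_facets hp' hq' hpq' hyF.1 hyF.2).2
      (Or.inr ⟨x, hx, hn.1, hn.2, hyx.2⟩))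
  have hfac : facet V p ∩ facet V q = facet V p' ∩ facet V q' := by
    rcases hne hp hy.1.1 with rfl | rfl <;> rcases hne hq hy.1.2 with rfl | rfl
    · exact absurd rfl hpq
    · rfl
    · exact inter_comm _ _
    · exact absurd rfl hpq
  rw [hfac, connectedComponentIn_eq (y := y)]
  rw [hcc]
  obtain ⟨t, ht, rfl⟩ := hye
  refine ⟨t, ⟨ht.1.lt_of_ne ?_, ht.2.lt_of_ne ?_⟩, rfl⟩ <;> rintro rfl
  exacts [hy.2 ha, hy.2 hb]

/-- For a fixed pair of centers, an edge is determined by the parameters of its two ends, which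
range over a finite set. -/
theorem finite_edges (h : IsThreeTight V) : {e | IsEdge V e}.Finite := by
  have key (c : E3 × E3) (hc : c ∈ (V ×ˢ V) \ {c : E3 × E3 | c.1 = c.2}) :
      {e | ∃ x ∈ (facet V c.1 ∩ facet V c.2) \ vertices V,
        e = closure (connectedComponentIn ((facet V c.1 ∩ facet V c.2) \ vertices V) x)}.Finite := by
    obtain ⟨y₀, γ, τ, hγ, hy₀, -⟩ := h.exists_chart hc.1.1 hc.1.2 hc.2
    have hT : (γ ⁻¹' vertices V).Finite := h.finite_vertices.preimage hγ.injective.injOn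
    refine (hT.image2 (fun a b => γ '' Icc a b) hT).subset ?_
    rintro e ⟨x, hx, rfl⟩
    obtain ⟨a, b, hab, ha, hb, -, -, -, he⟩ := hγ.exists_arc h.finite hc.1.1 hc.1.2 hc.2 hy₀ hx
    exact ⟨a, ha, b, hb, he.symm⟩
  refine (((h.finite.prod h.finite).subset (sdiff_subset (t := {c : E3 × E3 | c.1 = c.2}))).biUnion
    key).subset ?_
  rintro e ⟨p, hp, q, hq, hpq, x, hx, he⟩
  exact mem_biUnion (x := (p, q)) ⟨⟨hp, hq⟩, hpq⟩ ⟨x, hx, he⟩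

/-- Given disjoint closed parts, each facet boundary without `z` lies in one of them, which puts
each facet in a class. Connectedness of the frontier without `z` yields a point other than `z` on
facets of both classes. If these facets differ, the point lies on both of their boundaries, hence in
both parts. -/
theorem isPreconnected_iUnion_facetBoundary_diff (h : IsThreeTight V) (z : E3) :
    IsPreconnected ((⋃ p ∈ V, facetBoundary V p) \ {z}) := by
  rw [isPreconnected_closed_iff]
  intro t t' ht ht' hcov hne hne'
  by_contra hemp
  rw [not_nonempty_iff_eq_empty] at hemp
  have hnot {p y : E3} (hp : p ∈ V) (hy : y ∈ facetBoundary V p) (hyz : y ≠ z) (hyt : y ∈ t)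
      (hyt' : y ∈ t') : False := by
    have : y ∈ (∅ : Set E3) := hemp ▸ ⟨⟨mem_biUnion hp hy, hyz⟩, hyt, hyt'⟩
    exact this
  have hsub (p) (hp : p ∈ V) : facetBoundary V p \ {z} ⊆ t ∨ facetBoundary V p \ {z} ⊆ t' := by
    obtain ⟨a, ha, ha'⟩ := h.exists_strict_facet_point hp
    obtain ⟨q, hq, hqp, -⟩ := h.exists_ne_ne p p
    have hpre := isPreconnected_facetBoundary_diff h.finite hq hqp ha ha' z
    refine (isPreconnected_iff_subset_of_disjoint_closed.1 hpre) t t' ht ht'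
      ((sdiff_subset_sdiff_left (subset_biUnion_of_mem hp)).trans hcov) ?_
    exact eq_empty_of_forall_notMem fun y hy => hnot hp hy.1.1 hy.1.2 hy.2.1 hy.2.2
  have hclosed (s : Set E3) : IsClosed (⋃ p ∈ {p ∈ V | facetBoundary V p \ {z} ⊆ s}, facet V p) :=
    (h.finite.subset (sep_subset _ _)).isClosed_biUnion fun p _ => isClosed_facet V p
  obtain ⟨c, hc⟩ := h.center
  have hbd := isPreconnected_ballSet_boundary_diff h.finite h.nonempty hc z
  obtain ⟨y, ⟨hyB, hyz⟩, hy, hy'⟩ := isPreconnected_closed_iff.1 hbd _ _ (hclosed t) (hclosed t') (by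
    rintro y ⟨⟨hyB, p, hp, hyp⟩, -⟩
    rcases hsub p hp with hs | hs
    · exact Or.inl (mem_biUnion (x := p) ⟨hp, hs⟩ ⟨hyB, hyp⟩)
    · exact Or.inr (mem_biUnion (x := p) ⟨hp, hs⟩ ⟨hyB, hyp⟩)) (by
    obtain ⟨y, ⟨hy, hyz⟩, hyt⟩ := hne
    obtain ⟨p, hp, hyp⟩ := mem_iUnion₂.1 hy
    refine ⟨y, ⟨⟨hyp.1.1, p, hp, hyp.1.2⟩, hyz⟩, mem_biUnion (x := p) ⟨hp, ?_⟩ hyp.1⟩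
    exact (hsub p hp).resolve_right fun hs => hnot hp hyp hyz hyt (hs ⟨hyp, hyz⟩)) (by
    obtain ⟨y, ⟨hy, hyz⟩, hyt⟩ := hne'
    obtain ⟨p, hp, hyp⟩ := mem_iUnion₂.1 hy
    refine ⟨y, ⟨⟨hyp.1.1, p, hp, hyp.1.2⟩, hyz⟩, mem_biUnion (x := p) ⟨hp, ?_⟩ hyp.1⟩
    exact (hsub p hp).resolve_left fun hs => hnot hp hyp hyz (hs ⟨hyp, hyz⟩) hyt)
  obtain ⟨p, ⟨hp, hpt⟩, hyp⟩ := mem_iUnion₂.1 hy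
  obtain ⟨q, ⟨hq, hqt⟩, hyq⟩ := mem_iUnion₂.1 hy'
  rcases eq_or_ne p q with rfl | hpq
  -- A facet could belong to both classes only if its boundary had no point besides `z`, but that
  -- boundary is infinite.
  · obtain ⟨a, ha, ha'⟩ := h.exists_strict_facet_point hp
    obtain ⟨q, hq, hqp, -⟩ := h.exists_ne_ne p p
    obtain ⟨w, hw, hwz⟩ := ((infinite_facetBoundary h.finite hq hqp ha ha').sdiff
      (finite_singleton z)).nonempty
    exact hnot hp hw hwz (hpt ⟨hw, hwz⟩) (hqt ⟨hw, hwz⟩)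
  · have hyp' : y ∈ facetBoundary V p := ⟨hyp, q, hq, hpq.symm, hyq.2⟩
    have hyq' : y ∈ facetBoundary V q := ⟨hyq, p, hp, hpq, hyp.2⟩
    exact hnot hp hyp' hyz (hpt ⟨hyp', hyz⟩) (hqt ⟨hyq', hyz⟩)

/-! ### From topological connectedness to paths in the skeleton. -/

theorem exists_edge_of_notMem_vertices {p q y : E3} (hp : p ∈ V) (hq : q ∈ V) (hpq : p ≠ q)
    (hy : y ∈ (facet V p ∩ facet V q) \ vertices V) : ∃ e, IsEdge V e ∧ y ∈ e :=
  ⟨_, ⟨p, hp, q, hq, hpq, y, hy, rfl⟩, subset_closure (mem_connectedComponentIn hy)⟩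

/-- The union of a set of vertices and of all edges that meet it. -/
def star (V A : Set E3) : Set E3 := A ∪ ⋃ e ∈ {e | IsEdge V e ∧ (e ∩ A).Nonempty}, e

theorem isClosed_star (h : IsThreeTight V) {A : Set E3} (hA : A ⊆ vertices V) :
    IsClosed (star V A) :=
  (h.finite_vertices.subset hA).isClosed.union
    ((h.finite_edges.subset fun _ he => he.1).isClosed_biUnion fun _ he => he.1.isClosed)

theorem isLink_of_mem (h : IsThreeTight V) {e : Set E3} (he : IsEdge V e) {x y : E3} (hxy : x ≠ y)
    (hx : x ∈ e ∩ vertices V) (hy : y ∈ e ∩ vertices V) : (skeleton V).IsLink e x y := by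
  obtain ⟨a, b, -, hab⟩ := h.exists_inter_vertices_eq_pair he
  refine ⟨he, hab.trans ?_⟩
  rw [hab] at hx hy
  rcases hx with rfl | rfl <;> rcases hy with rfl | rfl
  · exact absurd rfl hxy
  · rfl
  · exact pair_comm _ _
  · exact absurd rfl hxy

/-- The stars of the vertices reached from `x` and of those not reached are closed and cover the
union of the facet boundaries without `z`. A common point off `z` produces one edge with an end in
each class, which would extend a path. -/
theorem reflTransGen_adj_ne (h : IsThreeTight V) {z x y : E3} (hx : x ∈ vertices V)
    (hy : y ∈ vertices V) (hxz : x ≠ z) (hyz : y ≠ z) :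
    Relation.ReflTransGen (fun a b => ∃ e, (skeleton V).IsLink e a b ∧ a ≠ z ∧ b ≠ z) x y := by
  set R := Relation.ReflTransGen (fun a b => ∃ e, (skeleton V).IsLink e a b ∧ a ≠ z ∧ b ≠ z)
  by_contra hn
  set A := {v ∈ vertices V | v ≠ z ∧ R x v} with hA
  set A' := {v ∈ vertices V | v ≠ z ∧ ¬R x v} with hA'
  have hAA' {v w : E3} {e : Set E3} (he : IsEdge V e) (hv : v ∈ e) (hw : w ∈ e) (hvA : v ∈ A)
      (hwA : w ∈ A') : False := by
    have hvw : v ≠ w := by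
      rintro rfl
      exact hwA.2.2 hvA.2.2
    exact hwA.2.2 (hvA.2.2.tail
      ⟨e, h.isLink_of_mem he hvw ⟨hv, hvA.1⟩ ⟨hw, hwA.1⟩, hvA.2.1, hwA.2.1⟩)
  have hvert {v : E3} (hv : v ∈ vertices V) : v ∈ ⋃ p ∈ V, facetBoundary V p := by
    obtain ⟨p, hp, q, hq, hpq, hvp, hvq⟩ := exists_facets_of_mem_vertices hv
    exact mem_biUnion hp ⟨hvp, q, hq, hpq.symm, hvq.2⟩
  obtain ⟨y, ⟨hyK, hyz⟩, hyA, hyA'⟩ := isPreconnected_closed_iff.1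
    (h.isPreconnected_iUnion_facetBoundary_diff z) _ _
    (h.isClosed_star (A := A) fun v hv => hv.1) (h.isClosed_star (A := A') fun v hv => hv.1) (by
      rintro y ⟨hyK, hyz⟩
      by_cases hyv : y ∈ vertices V
      · by_cases hR : R x y
        · exact Or.inl (Or.inl ⟨hyv, hyz, hR⟩)
        · exact Or.inr (Or.inl ⟨hyv, hyz, hR⟩)
      obtain ⟨p, hp, hyp, q, hq, hqp, hyq⟩ := mem_iUnion₂.1 hyK
      obtain ⟨e, he, hye⟩ :=
        exists_edge_of_notMem_vertices hp hq hqp.symm ⟨⟨hyp, hyp.1, hyq⟩, hyv⟩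
      -- Because the two ends are distinct, an edge at `z` still has an end that survives and puts
      -- it in a star.
      obtain ⟨v, hv, hvz⟩ : ∃ v ∈ e ∩ vertices V, v ≠ z := by
        obtain ⟨a, b, hab, hev⟩ := h.exists_inter_vertices_eq_pair he
        rw [hev]
        by_cases haz : a = z
        · exact ⟨b, Or.inr rfl, fun hbz => hab (haz.trans hbz.symm)⟩
        · exact ⟨a, Or.inl rfl, haz⟩
      by_cases hR : R x v
      · exact Or.inl (Or.inr (mem_biUnion (x := e) ⟨he, v, hv.1, hv.2, hvz, hR⟩ hye))
      · exact Or.inr (Or.inr (mem_biUnion (x := e) ⟨he, v, hv.1, hv.2, hvz, hR⟩ hye)))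
    ⟨x, ⟨hvert hx, hxz⟩, Or.inl ⟨hx, hxz, .refl⟩⟩ ⟨y, ⟨hvert hy, hyz⟩, Or.inl ⟨hy, hyz, hn⟩⟩
  by_cases hyv : y ∈ vertices V
  · by_cases hR : R x y
    · rcases hyA' with hy' | hy'
      · exact hy'.2.2 hR
      · obtain ⟨e, ⟨he, w, hwe, hwA⟩, hye⟩ := mem_iUnion₂.1 hy'
        exact hAA' he hye hwe ⟨hyv, hyz, hR⟩ hwA
    · rcases hyA with hy' | hy'
      · exact hR hy'.2.2
      · obtain ⟨e, ⟨he, w, hwe, hwA⟩, hye⟩ := mem_iUnion₂.1 hy'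
        exact hAA' he hwe hye hwA ⟨hyv, hyz, hR⟩
  · obtain ⟨e, ⟨he, v, hve, hvA⟩, hye⟩ := mem_iUnion₂.1 (hyA.resolve_left fun h' => hyv h'.1)
    obtain ⟨e', ⟨he', w, hwe, hwA⟩, hye'⟩ := mem_iUnion₂.1 (hyA'.resolve_left fun h' => hyv h'.1)
    obtain ⟨p, hp, hyp, q, hq, hqp, hyq⟩ := mem_iUnion₂.1 hyK
    have hyF : y ∈ (facet V p ∩ facet V q) \ vertices V := ⟨⟨hyp, hyp.1, hyq⟩, hyv⟩
    have hee : e = e' := (h.eq_closure_of_mem_edge he hp hq hqp.symm hyF hye).trans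
      (h.eq_closure_of_mem_edge he' hp hq hqp.symm hyF hye').symm
    exact hAA' he hve (hee ▸ hwe) hvA hwA

theorem exists_ne_mem_vertices (h : IsThreeTight V) : ∃ x ∈ vertices V, ∃ y ∈ vertices V, x ≠ y := by
  obtain ⟨p, hp⟩ := h.nonempty
  obtain ⟨a, ha, ha'⟩ := h.exists_strict_facet_point hp
  obtain ⟨q, hq, hqp, -⟩ := h.exists_ne_ne p p
  obtain ⟨y, ⟨hyp, q', hq', hqp', hyq⟩, hyv⟩ :=
    ((infinite_facetBoundary h.finite hq hqp ha ha').sdiff h.finite_vertices).nonempty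
  obtain ⟨e, he, -⟩ := exists_edge_of_notMem_vertices hp hq' hqp'.symm ⟨⟨hyp, hyp.1, hyq⟩, hyv⟩
  obtain ⟨x, y, hxy, hev⟩ := h.exists_inter_vertices_eq_pair he
  have hx : x ∈ e ∩ vertices V := hev ▸ Or.inl rfl
  have hy : y ∈ e ∩ vertices V := hev ▸ Or.inr rfl
  exact ⟨x, hx.2, y, hy.2, hxy⟩

theorem twoConnected_skeleton (h : IsThreeTight V) : TwoConnected (skeleton V) := by
  obtain ⟨x, hx, y, hy, hxy⟩ := h.exists_ne_mem_vertices
  refine ⟨?_, ⟨⟨x, hx⟩, fun v hv w hw => ?_⟩, fun z hz => ⟨?_, fun v hv w hw => ?_⟩⟩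
  · rw [← encard_pair hxy]
    exact encard_le_encard (pair_subset hx hy)
  -- Avoiding a point that is not a vertex is no restriction, so connectedness is a case of the
  -- deletion statement.
  · obtain ⟨z, hz⟩ := h.finite_vertices.exists_notMem
    refine Relation.ReflTransGen.mono (fun a b ⟨e, he, _⟩ => ⟨e, he⟩) _ _
      (h.reflTransGen_adj_ne (z := z) hv hw ?_ ?_)
    · rintro rfl
      exact hz hv
    · rintro rfl
      exact hz hw
  · rw [Graph.vertexSet_deleteVerts]
    by_cases hxz : x = z
    · exact ⟨y, hy, fun hyz => hxy (hxz.trans (mem_singleton_iff.1 hyz).symm)⟩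
    · exact ⟨x, hx, hxz⟩
  · rw [Graph.vertexSet_deleteVerts] at hv hw
    refine Relation.ReflTransGen.mono (fun a b ⟨e, he, ha, hb⟩ => ⟨e, ?_⟩) _ _
      (h.reflTransGen_adj_ne (z := z) hv.1 hw.1 hv.2 hw.2)
    rw [Graph.deleteVerts_isLink]
    exact ⟨he, ha, hb⟩

end IsThreeTight

end BallPolytope

/-- If `V ⊆ ℝ³` is finite and tight (in particular of circumradius less than `1`) and has at least
three points, then the edges of `B(V)` all have exactly two (distinct) ends, so that the
`1`-skeleton is a loopless multigraph on all vertices and edges, and this multigraph is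
`2`-connected. -/
theorem theorem6p1 (V : Set E3) (hfin : V.Finite) (hcard : 3 ≤ V.encard)
    (hcr : BallPolytope.circumradius V < 1) (htight : BallPolytope.IsTight V) :
    (∀ e : Set E3, BallPolytope.IsEdge V e →
      ∃ x y : E3, x ≠ y ∧ (BallPolytope.skeleton V).IsLink e x y) ∧
    BallPolytope.TwoConnected (BallPolytope.skeleton V) := by
  have h : BallPolytope.IsThreeTight V :=
    ⟨hfin, hcard, BallPolytope.exists_dist_lt_one_of_circumradius_lt hcr, fun p hp =>
      BallPolytope.exists_one_lt_dist_of_mem_essentialPoints (htight.essential.symm ▸ hp)⟩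
  refine ⟨fun e he => ?_, h.twoConnected_skeleton⟩
  obtain ⟨x, y, hxy, hev⟩ := h.exists_inter_vertices_eq_pair he
  exact ⟨x, y, hxy, he, hev⟩
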